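/- Let $N\ge 1$, let $\Omega\subset\mathbb R^N$ be a bounded domain, and let $p\in C^1(\overline\Omega)$ with $p_-:=\min_{\overline\Omega}p>1$. Let $1<q\le p_-$ and $\lambda>0$. Let $h\in L^{p_0}(\Omega)$ with $2\le p_0\le\infty$ and $h\ge 0$ a.e. in $\Omega$. Let $f:\Omega\times[0,\infty)\to[0,\infty)$ satisfy * $(f_1)$ $f(x,0)=0$ for all $x\in\Omega$, and $f\not\equiv 0$; * $(f_3)$ for every $x\in\Omega$, the map $s\mapsto f(x,s)/s^{q-1}$ is nonincreasing on $(0,\infty)$. Let $W^{1,p(x)}(\Omega)$ be the space of measurable $u$ on $\Omega$ having a weak gradient such that $\int_\Omega|u|^{p(x)}dx<\infty$ and $\int_\Omega|\nabla u|^{p(x)}dx<\infty$. Put $W_0^{1,p(x)}(\Omega)=W_0^{1,1}(\Omega)\cap W^{1,p(x)}(\Omega)$, where $W_0^{1,1}(\Omega)$ is the closure of $C_c^\infty(\Omega)$ in $W^{1,1}(\Omega)$, and let $\mathbf W=W_0^{1,p(x)}(\Omega)\cap L^{2q}(\Omega)$. Consider the problem $$(E_1)\qquad v^{2q-1}-\lambda\Delta_{p(x)}v=h(x)v^{q-1}+\lambda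 f(x,v)\ \text{ in }\Omega,\qquad v>0\ \text{ in }\Omega,\qquad v=0\ \text{ on }\partial\Omega,$$ where $\Delta_{p(x)}v=\operatorname{div}(|\nabla v|^{p(x)-2}\nabla v)$. A weak subsolution of $(E_1)$ is a function $v\in\mathbf W$ with $v>0$ a.e. in $\Omega$ such that, for every $\phi\in\mathbf W$ with $\phi\ge 0$ a.e., $f(\cdot,v)\phi\in L^1(\Omega)$ and $$\int_\Omega v^{2q-1}\phi\,dx+\lambda\int_\Omega|\nabla v|^{p(x)-2}\nabla v\cdot\nabla\phi\,dx\ \le\ \int_\Omega h\,v^{q-1}\phi\,dx+\lambda\int_\Omega f(x,v)\phi\,dx .$$ A weak supersolution of $(E_1)$ is a function $\tilde v\in W^{1,p(x)}(\Omega)\cap L^{2q}(\Omega)$ with $\tilde v>0$ a.e. in $\Omega$ (no zero boundary value is required; in particular $\tilde v\in\mathbf W$ is allowed) such that, for every $\phi\in\mathbf W$ with $\phi\ge 0$ a.e., $f(\cdot,\tilde v)\phi\in L^1(\Omega)$ and the reverse inequality holds with $\tilde v$ in place of $v$. **Theorem.** If $v$ is a weak subsolution and $\tilde v$ a weak supersolution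 of $(E_1)$, then $v\le\tilde v$ a.e. in $\Omega$. -/

import Mathlib

open MeasureTheory Filter Topology
open scoped ENNReal ContDiff

namespace VarExp

/-- Test functions on `Ω`: smooth functions with compact support contained in `Ω`. -/
def IsTestFunction {N : ℕ} (Ω : Set (EuclideanSpace ℝ (Fin N)))
    (φ : EuclideanSpace ℝ (Fin N) → ℝ) : Prop :=
  ContDiff ℝ ∞ φ ∧ HasCompactSupport φ ∧ tsupport φ ⊆ Ω

/-- `G` is the weak (distributional) gradient of `u` in `Ω`:
`∫_Ω u ∇φ = - ∫_Ω φ G` for every test function `φ`, with `u` and `G` locally integrable. -/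
def HasWeakGradient {N : ℕ} (Ω : Set (EuclideanSpace ℝ (Fin N)))
    (u : EuclideanSpace ℝ (Fin N) → ℝ)
    (G : EuclideanSpace ℝ (Fin N) → EuclideanSpace ℝ (Fin N)) : Prop :=
  LocallyIntegrableOn u Ω ∧ LocallyIntegrableOn G Ω ∧
    ∀ φ : EuclideanSpace ℝ (Fin N) → ℝ, IsTestFunction Ω φ →
      ∫ x in Ω, u x • gradient φ x = -∫ x in Ω, φ x • G x

/-- Membership in the variable exponent Lebesgue space `L^{p(x)}(Ω)`:
`u` is measurable and `∫_Ω |u|^{p(x)} dx < ∞`. -/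
def MemLpVar {N : ℕ} {F : Type*} [NormedAddCommGroup F]
    (Ω : Set (EuclideanSpace ℝ (Fin N))) (p : EuclideanSpace ℝ (Fin N) → ℝ)
    (u : EuclideanSpace ℝ (Fin N) → F) : Prop :=
  AEStronglyMeasurable u (volume.restrict Ω) ∧ IntegrableOn (fun x => ‖u x‖ ^ p x) Ω

/-- `u ∈ W^{1,p(x)}(Ω)`, with weak gradient `G`. -/
def MemW1 {N : ℕ} (Ω : Set (EuclideanSpace ℝ (Fin N))) (p : EuclideanSpace ℝ (Fin N) → ℝ)
    (u : EuclideanSpace ℝ (Fin N) → ℝ)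
    (G : EuclideanSpace ℝ (Fin N) → EuclideanSpace ℝ (Fin N)) : Prop :=
  MemLpVar Ω p u ∧ MemLpVar Ω p G ∧ HasWeakGradient Ω u G

/-- `u`, with weak gradient `G`, lies in the closure of the test functions in `W^{1,1}(Ω)`,
that is, `u ∈ W_0^{1,1}(Ω)`. -/
def MemW011 {N : ℕ} (Ω : Set (EuclideanSpace ℝ (Fin N)))
    (u : EuclideanSpace ℝ (Fin N) → ℝ)
    (G : EuclideanSpace ℝ (Fin N) → EuclideanSpace ℝ (Fin N)) : Prop :=
  MemW1 Ω (fun _ => 1) u G ∧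
    ∃ φ : ℕ → EuclideanSpace ℝ (Fin N) → ℝ, (∀ n, IsTestFunction Ω (φ n)) ∧
      Tendsto (fun n => eLpNorm (fun x => u x - φ n x) 1 (volume.restrict Ω)) atTop (𝓝 0) ∧
      Tendsto (fun n => eLpNorm (fun x => G x - gradient (φ n) x) 1 (volume.restrict Ω))
        atTop (𝓝 0)

/-- `u ∈ 𝐖 = W_0^{1,p(x)}(Ω) ∩ L^{2q}(Ω)`, with weak gradient `G`, where
`W_0^{1,p(x)}(Ω) = W_0^{1,1}(Ω) ∩ W^{1,p(x)}(Ω)`. -/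
def MemW {N : ℕ} (Ω : Set (EuclideanSpace ℝ (Fin N))) (p : EuclideanSpace ℝ (Fin N) → ℝ)
    (q : ℝ) (u : EuclideanSpace ℝ (Fin N) → ℝ)
    (G : EuclideanSpace ℝ (Fin N) → EuclideanSpace ℝ (Fin N)) : Prop :=
  MemW011 Ω u G ∧ MemW1 Ω p u G ∧ MemLp u (ENNReal.ofReal (2 * q)) (volume.restrict Ω)

/-- The left-hand side `∫ v^{2q-1} φ + λ ∫ |∇v|^{p(x)-2} ∇v · ∇φ` of the weak formulation of
`v^{2q-1} - λ Δ_{p(x)} v = h v^{q-1} + λ f(x,v)`; here `G = ∇v` and `H = ∇φ`. -/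
noncomputable def weakLHS {N : ℕ} (Ω : Set (EuclideanSpace ℝ (Fin N)))
    (p : EuclideanSpace ℝ (Fin N) → ℝ) (q lam : ℝ)
    (v : EuclideanSpace ℝ (Fin N) → ℝ)
    (G : EuclideanSpace ℝ (Fin N) → EuclideanSpace ℝ (Fin N))
    (φ : EuclideanSpace ℝ (Fin N) → ℝ)
    (H : EuclideanSpace ℝ (Fin N) → EuclideanSpace ℝ (Fin N)) : ℝ :=
  (∫ x in Ω, v x ^ (2 * q - 1) * φ x)
    + lam * ∫ x in Ω, inner ℝ (‖G x‖ ^ (p x - 2) • G x) (H x)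

/-- The right-hand side `∫ h v^{q-1} φ + λ ∫ f(x,v) φ` of the weak formulation. -/
noncomputable def weakRHS {N : ℕ} (Ω : Set (EuclideanSpace ℝ (Fin N))) (q lam : ℝ)
    (h : EuclideanSpace ℝ (Fin N) → ℝ) (f : EuclideanSpace ℝ (Fin N) → ℝ → ℝ)
    (v : EuclideanSpace ℝ (Fin N) → ℝ) (φ : EuclideanSpace ℝ (Fin N) → ℝ) : ℝ :=
  (∫ x in Ω, h x * v x ^ (q - 1) * φ x) + lam * ∫ x in Ω, f x (v x) * φ x

/-- Weak subsolution of `v^{2q-1} - λ Δ_{p(x)} v = h v^{q-1} + λ f(x,v)`, `v > 0` in `Ω`,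
`v = 0` on `∂Ω`. The subsolution is positive and at most `0` on the boundary, so it lies in
`W_0^{1,p(x)}(Ω)`. The reaction term is required to be integrable against every admissible
test function, so that the inequality compares finite integrals (the other three integrals
are finite automatically when `h ∈ L²`). -/
def IsWeakSubsolution {N : ℕ} (Ω : Set (EuclideanSpace ℝ (Fin N)))
    (p : EuclideanSpace ℝ (Fin N) → ℝ) (q lam : ℝ)
    (h : EuclideanSpace ℝ (Fin N) → ℝ) (f : EuclideanSpace ℝ (Fin N) → ℝ → ℝ)
    (v : EuclideanSpace ℝ (Fin N) → ℝ) : Prop :=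
  (∀ᵐ x ∂volume.restrict Ω, 0 < v x) ∧
  ∃ G : EuclideanSpace ℝ (Fin N) → EuclideanSpace ℝ (Fin N), MemW Ω p q v G ∧
    ∀ φ H, MemW Ω p q φ H → (∀ᵐ x ∂volume.restrict Ω, 0 ≤ φ x) →
      IntegrableOn (fun x => f x (v x) * φ x) Ω ∧
      weakLHS Ω p q lam v G φ H ≤ weakRHS Ω q lam h f v φ

/-- Weak supersolution of the same problem. Only `v ∈ W^{1,p(x)}(Ω) ∩ L^{2q}(Ω)` is required:
`v ≥ 0` on the boundary holds because `v` is positive; every `v` in `𝐖` is covered. -/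
def IsWeakSupersolution {N : ℕ} (Ω : Set (EuclideanSpace ℝ (Fin N)))
    (p : EuclideanSpace ℝ (Fin N) → ℝ) (q lam : ℝ)
    (h : EuclideanSpace ℝ (Fin N) → ℝ) (f : EuclideanSpace ℝ (Fin N) → ℝ → ℝ)
    (v : EuclideanSpace ℝ (Fin N) → ℝ) : Prop :=
  (∀ᵐ x ∂volume.restrict Ω, 0 < v x) ∧
  ∃ G : EuclideanSpace ℝ (Fin N) → EuclideanSpace ℝ (Fin N),
    (MemW1 Ω p v G ∧ MemLp v (ENNReal.ofReal (2 * q)) (volume.restrict Ω)) ∧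
    ∀ φ H, MemW Ω p q φ H → (∀ᵐ x ∂volume.restrict Ω, 0 ≤ φ x) →
      IntegrableOn (fun x => f x (v x) * φ x) Ω ∧
      weakRHS Ω q lam h f v φ ≤ weakLHS Ω p q lam v G φ H

/-- `(f₁)`: `f : Ω × [0,∞) → [0,∞)`, `f(x,0) = 0` for all `x ∈ Ω`, and `f ≢ 0`. -/
def CondF1 {N : ℕ} (Ω : Set (EuclideanSpace ℝ (Fin N)))
    (f : EuclideanSpace ℝ (Fin N) → ℝ → ℝ) : Prop :=
  (∀ x ∈ Ω, ∀ s, 0 ≤ s → 0 ≤ f x s) ∧ (∀ x ∈ Ω, f x 0 = 0) ∧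
    ∃ x ∈ Ω, ∃ s, 0 ≤ s ∧ f x s ≠ 0

/-- `(f₃)`: for every `x ∈ Ω`, `s ↦ f(x,s) / s^{q-1}` is nonincreasing on `(0,∞)`. -/
def CondF3 {N : ℕ} (Ω : Set (EuclideanSpace ℝ (Fin N))) (q : ℝ)
    (f : EuclideanSpace ℝ (Fin N) → ℝ → ℝ) : Prop :=
  ∀ x ∈ Ω, AntitoneOn (fun s : ℝ => f x s / s ^ (q - 1)) (Set.Ioi 0)

end VarExp

/-! The argument is the Díaz–Saá method. Write `w` for the supersolution. Formally, test the
subsolution with `(v^q - w^q)⁺ / v^(q-1)` and the supersolution with `(v^q - w^q)⁺ / w^(q-1)`, and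
subtract. The `h` terms cancel, the reaction terms contribute with a favourable sign because
`f(x,s)/s^(q-1)` is nonincreasing, and the diffusion terms are nonnegative by a Picone inequality,
valid pointwise because `q ≤ p x`. What remains is `∫ ((v^q - w^q)⁺)² ≤ 0`, so `v ≤ w` a.e.

These quotients need not be admissible, so they are regularized. With `s = min v k + ε` and `m = min
(min v k) w + ε`, use `φ = (s^q - m^q) s^(1-q)` and `ψ = (s^q - m^q) m^(1-q)`. Both `s` and `m` take
values in `[ε, k + ε]`, where the powers are smooth, which gives the weak gradients and their
bounds. Both test functions lie between `0` and a multiple of `v`, so `MemW011.of_le` supplies the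
zero boundary values with no regularity of `Ω` and no boundary condition on `w`.

The price is threefold: an energy error on `{v > k}` (`energy_lower_bound`), and inexact
cancellation in the `h` terms and in the reaction terms. All are collected in
`comparison_inequality` and vanish for `k = n + 1`, `ε = 1/(n + 1)` by dominated convergence. The
weights `v^(q-1) φ` and `w^(q-1) ψ` lie between `0` and `q v^q` uniformly in `k` and `ε` and vanish
where `v ≤ w`, so the mass, `h` and reaction integrands have dominating functions built from `v`,
`h` and `f(x,v)` alone.

The calculus of weak gradients (mollification, chain rule, lattice operations) is developed from the
definition. -/

namespace VarExp

variable {N : ℕ} {Ω : Set (EuclideanSpace ℝ (Fin N))}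

local notation "𝔼" N => EuclideanSpace ℝ (Fin N)

/-! ### Mollification in `L¹`. -/

section Mollification

variable {E F : Type*} [NormedAddCommGroup E] [NormedSpace ℝ E] [FiniteDimensional ℝ E]
  [MeasurableSpace E] [BorelSpace E] {μ : Measure E} [μ.IsAddHaarMeasure]
  [NormedAddCommGroup F]

/-- Continuity of translations in `L¹`. -/
lemma tendsto_lintegral_translate_sub {g : E → F} (hg : Integrable g μ) :
    Tendsto (fun t => ∫⁻ x, ‖g (x - t) - g x‖ₑ ∂μ) (𝓝 0) (𝓝 0) := by
  have hmp : ∀ t : E, MeasurePreserving (fun x : E => x - t) μ μ :=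
    fun t => measurePreserving_sub_right μ t
  let G : E → C(E, E) := fun t => ⟨fun x => x - t, by fun_prop⟩
  have hG : Continuous G := by
    apply ContinuousMap.continuous_of_continuous_uncurry
    exact continuous_snd.sub continuous_fst
  -- Composition with a continuously varying family of measure preserving maps acts continuously on
  -- `L¹`; the claim is continuity at `t = 0`.
  have hc := (continuous_const (y := hg.toL1 g)).compMeasurePreservingLp (p := 1) hG hmp
    ENNReal.one_ne_top
  have h0 := (hc.tendsto 0)
  rw [Lp.tendsto_Lp_iff_tendsto_eLpNorm'] at h0
  refine h0.congr fun t => ?_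
  rw [eLpNorm_one_eq_lintegral_enorm]
  apply lintegral_congr_ae
  have h1 : (Lp.compMeasurePreserving (G t) (hmp t) (hg.toL1 g) : E → F) =ᵐ[μ]
      fun x => g (x - t) := by
    refine (Lp.coeFn_compMeasurePreserving _ (hmp t)).trans ?_
    exact (hmp t).quasiMeasurePreserving.ae_eq_comp hg.coeFn_toL1
  have h2 : (Lp.compMeasurePreserving (G 0) (hmp 0) (hg.toL1 g) : E → F) =ᵐ[μ] g := by
    refine (Lp.coeFn_compMeasurePreserving _ (hmp 0)).trans ?_
    refine ((hmp 0).quasiMeasurePreserving.ae_eq_comp hg.coeFn_toL1).trans ?_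
    exact Eventually.of_forall fun x => by simp
  filter_upwards [h1, h2] with x hx1 hx2
  rw [Pi.sub_apply, hx1, hx2]

variable [NormedSpace ℝ F] [CompleteSpace F]

/-- Mollifications of an integrable function converge to it in `L¹`. -/
lemma tendsto_lintegral_mollify_sub {g : E → F} (hg : Integrable g μ)
    {φ : ℕ → ContDiffBump (0 : E)} (hφ : Tendsto (fun n => (φ n).rOut) atTop (𝓝 0)) :
    Tendsto (fun n => ∫⁻ x, ‖(∫ t, (φ n).normed μ t • g (x - t) ∂μ) - g x‖ₑ ∂μ) atTop (𝓝 0) := by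
  rw [ENNReal.tendsto_nhds_zero]
  intro ε hε
  have h0 := (ENNReal.tendsto_nhds_zero.1 (tendsto_lintegral_translate_sub hg)) ε hε
  obtain ⟨δ, hδ, hball⟩ := Metric.eventually_nhds_iff_ball.1 h0
  filter_upwards [hφ.eventually_lt_const hδ] with n hn
  set ρ := (φ n).normed μ with hρ
  have hρc : Continuous ρ := (φ n).continuous_normed
  have hρi : Integrable ρ μ := (φ n).integrable_normed
  have hρ1 : ∫⁻ t, ‖ρ t‖ₑ ∂μ = 1 := by
    have h1 := ofReal_integral_eq_lintegral_ofReal hρi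
      (Eventually.of_forall fun t => (φ n).nonneg_normed t)
    rw [(φ n).integral_normed, ENNReal.ofReal_one] at h1
    rw [h1]
    exact lintegral_congr fun t => Real.enorm_of_nonneg ((φ n).nonneg_normed t)
  have hconv : Integrable (fun z : E × E => ρ z.2 • g (z.1 - z.2)) (μ.prod μ) :=
    hρi.convolution_integrand (ContinuousLinearMap.lsmul ℝ ℝ) hg
  have hdiff : AEStronglyMeasurable (fun z : E × E => ρ z.2 • (g (z.1 - z.2) - g z.1))
      (μ.prod μ) := by
    simp only [smul_sub]
    exact hconv.aestronglyMeasurable.sub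
      ((hρc.comp continuous_snd).aestronglyMeasurable.smul hg.aestronglyMeasurable.comp_fst)
  -- Since `ρ` has integral one, the error is an average of translation errors `g (x - t) - g x`;
  -- after Tonelli only `t` in the support of `ρ`, inside the `δ`-ball, matter.
  calc ∫⁻ x, ‖(∫ t, ρ t • g (x - t) ∂μ) - g x‖ₑ ∂μ
      ≤ ∫⁻ x, ∫⁻ t, ‖ρ t • (g (x - t) - g x)‖ₑ ∂μ ∂μ := by
        apply lintegral_mono_ae
        filter_upwards [hconv.prod_right_ae] with x hx
        have : (∫ t, ρ t • g (x - t) ∂μ) - g x = ∫ t, ρ t • (g (x - t) - g x) ∂μ := by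
          simp only [smul_sub]
          rw [integral_sub hx (hρi.smul_const _), integral_smul_const, hρ, (φ n).integral_normed,
            one_smul]
        rw [this]
        exact enorm_integral_le_lintegral_enorm _
    _ = ∫⁻ t, ∫⁻ x, ‖ρ t • (g (x - t) - g x)‖ₑ ∂μ ∂μ :=
        lintegral_lintegral_swap hdiff.enorm
    _ ≤ ∫⁻ t, ‖ρ t‖ₑ * ε ∂μ := by
        apply lintegral_mono
        intro t
        simp only [enorm_smul]
        rw [lintegral_const_mul' _ _ enorm_ne_top]
        by_cases ht : t ∈ Metric.ball (0 : E) δ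
        · gcongr
          exact hball t ht
        · have : ρ t = 0 := by
            have : t ∉ Function.support ρ := by
              rw [(φ n).support_normed_eq]
              exact fun h => ht (Metric.ball_subset_ball hn.le h)
            simpa using this
          simp [this]
    _ = ε := by
        rw [lintegral_mul_const _ hρc.measurable.enorm, hρ1, one_mul]

end Mollification

/-! ### Elementary calculus of weak gradients. -/

section Basics

lemma continuous_gradient {φ : (𝔼 N) → ℝ} (hφ : ContDiff ℝ 1 φ) : Continuous (gradient φ) :=
  (InnerProductSpace.toDual ℝ (𝔼 N)).symm.continuous.comp (hφ.continuous_fderiv one_ne_zero)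

lemma gradient_eq_zero_of_notMem_tsupport {φ : (𝔼 N) → ℝ} {x : 𝔼 N} (hx : x ∉ tsupport φ) :
    gradient φ x = 0 := by
  have : fderiv ℝ φ x = 0 := by
    by_contra h
    exact hx (support_fderiv_subset ℝ h)
  simp [gradient, this]

lemma tsupport_gradient_subset (φ : (𝔼 N) → ℝ) : tsupport (gradient φ) ⊆ tsupport φ :=
  closure_minimal (fun x hx => by
    by_contra h
    exact hx (gradient_eq_zero_of_notMem_tsupport h)) (isClosed_tsupport φ)

lemma gradient_fun_mul {f g : (𝔼 N) → ℝ} {x : 𝔼 N} (hf : DifferentiableAt ℝ f x)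
    (hg : DifferentiableAt ℝ g x) :
    gradient (fun y => f y * g y) x = f x • gradient g x + g x • gradient f x := by
  simp [gradient, fderiv_fun_mul hf hg]

lemma IsTestFunction.gradient_continuous {φ : (𝔼 N) → ℝ} (hφ : IsTestFunction Ω φ) :
    Continuous (gradient φ) := continuous_gradient (hφ.1.of_le (by simp))

lemma IsTestFunction.gradient_hasCompactSupport {φ : (𝔼 N) → ℝ} (hφ : IsTestFunction Ω φ) :
    HasCompactSupport (gradient φ) :=
  hφ.2.1.mono' ((subset_tsupport _).trans (tsupport_gradient_subset φ))

lemma IsTestFunction.smooth_mul {φ η : (𝔼 N) → ℝ} (hφ : IsTestFunction Ω φ)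
    (hη : ContDiff ℝ ∞ η) : IsTestFunction Ω (fun x => η x * φ x) :=
  ⟨hη.mul hφ.1, hφ.2.1.mul_left, (tsupport_mul_subset_right).trans hφ.2.2⟩

variable {F : Type*} [NormedAddCommGroup F] [NormedSpace ℝ F]

lemma integrableOn_smul_of_tsupport_subset (hΩ : IsOpen Ω) {u : (𝔼 N) → F}
    (hu : LocallyIntegrableOn u Ω) {ζ : (𝔼 N) → ℝ} (hζ : Continuous ζ)
    (hc : HasCompactSupport ζ) (hs : tsupport ζ ⊆ Ω) :
    IntegrableOn (fun x => ζ x • u x) Ω := by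
  have h1 : IntegrableOn u (tsupport ζ) := hu.integrableOn_compact_subset hs hc
  refine IntegrableOn.of_forall_sdiff_eq_zero (h1.continuousOn_smul hζ.continuousOn hc)
    hΩ.measurableSet fun x hx => ?_
  simp [image_eq_zero_of_notMem_tsupport hx.2]

lemma integrableOn_smul_of_tsupport_subset' (hΩ : IsOpen Ω) {u : (𝔼 N) → ℝ}
    (hu : LocallyIntegrableOn u Ω) {Z : (𝔼 N) → F} (hζ : Continuous Z)
    (hc : HasCompactSupport Z) (hs : tsupport Z ⊆ Ω) :
    IntegrableOn (fun x => u x • Z x) Ω := by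
  have h1 : IntegrableOn u (tsupport Z) := hu.integrableOn_compact_subset hs hc
  refine IntegrableOn.of_forall_sdiff_eq_zero (h1.smul_continuousOn hζ.continuousOn hc)
    hΩ.measurableSet fun x hx => ?_
  simp [image_eq_zero_of_notMem_tsupport hx.2]

lemma HasWeakGradient.integrableOn_left (hΩ : IsOpen Ω) {u : (𝔼 N) → ℝ} {G : (𝔼 N) → 𝔼 N}
    (h : HasWeakGradient Ω u G) {φ : (𝔼 N) → ℝ} (hφ : IsTestFunction Ω φ) :
    IntegrableOn (fun x => u x • gradient φ x) Ω :=
  integrableOn_smul_of_tsupport_subset' hΩ h.1 hφ.gradient_continuous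
    hφ.gradient_hasCompactSupport ((tsupport_gradient_subset φ).trans hφ.2.2)

lemma HasWeakGradient.integrableOn_right (hΩ : IsOpen Ω) {u : (𝔼 N) → ℝ} {G : (𝔼 N) → 𝔼 N}
    (h : HasWeakGradient Ω u G) {φ : (𝔼 N) → ℝ} (hφ : IsTestFunction Ω φ) :
    IntegrableOn (fun x => φ x • G x) Ω :=
  integrableOn_smul_of_tsupport_subset hΩ h.2.1 hφ.1.continuous hφ.2.1 hφ.2.2

lemma LocallyIntegrableOn.congr_ae_restrict {F' : Type*} [NormedAddCommGroup F']
    (hΩ : IsOpen Ω) {u u' : (𝔼 N) → F'}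
    (hu : LocallyIntegrableOn u Ω) (h : u =ᵐ[volume.restrict Ω] u') :
    LocallyIntegrableOn u' Ω := by
  rw [locallyIntegrableOn_iff hΩ.isLocallyClosed] at hu ⊢
  exact fun K hK hc => (hu K hK hc).congr (ae_restrict_of_ae_restrict_of_subset hK h)

lemma HasWeakGradient.congr_ae (hΩ : IsOpen Ω) {u u' : (𝔼 N) → ℝ} {G G' : (𝔼 N) → 𝔼 N}
    (h : HasWeakGradient Ω u G) (hu : u =ᵐ[volume.restrict Ω] u')
    (hG : G =ᵐ[volume.restrict Ω] G') : HasWeakGradient Ω u' G' := by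
  refine ⟨LocallyIntegrableOn.congr_ae_restrict hΩ h.1 hu,
    LocallyIntegrableOn.congr_ae_restrict hΩ h.2.1 hG, fun φ hφ => ?_⟩
  have h1 : ∫ x in Ω, u' x • gradient φ x = ∫ x in Ω, u x • gradient φ x :=
    integral_congr_ae (hu.mono fun x hx => by simp only [hx])
  have h2 : ∫ x in Ω, φ x • G' x = ∫ x in Ω, φ x • G x :=
    integral_congr_ae (hG.mono fun x hx => by simp only [hx])
  rw [h1, h2, h.2.2 φ hφ]

lemma HasWeakGradient.ae_unique (hΩ : IsOpen Ω) {u : (𝔼 N) → ℝ} {G G' : (𝔼 N) → 𝔼 N}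
    (h : HasWeakGradient Ω u G) (h' : HasWeakGradient Ω u G') :
    G =ᵐ[volume.restrict Ω] G' := by
  rw [EventuallyEq, ae_restrict_iff' hΩ.measurableSet]
  have := hΩ.ae_eq_zero_of_integral_contDiff_smul_eq_zero (f := fun x => G x - G' x)
    (h.2.1.sub h'.2.1) (fun φ h1 h2 h3 => ?_)
  · filter_upwards [this] with x hx hxΩ
    exact sub_eq_zero.1 (hx hxΩ)
  · have hφ : IsTestFunction Ω φ := ⟨h1, h2, h3⟩
    rw [← setIntegral_eq_integral_of_forall_compl_eq_zero (s := Ω)]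
    · simp only [smul_sub]
      rw [integral_sub (h.integrableOn_right hΩ hφ) (h'.integrableOn_right hΩ hφ),
        ← neg_inj, neg_sub, sub_eq_neg_add, ← h.2.2 φ hφ, h'.2.2 φ hφ]
      simp
    · intro x hx
      simp [image_eq_zero_of_notMem_tsupport (fun hh => hx (h3 hh))]

lemma HasWeakGradient.add (hΩ : IsOpen Ω) {u u' : (𝔼 N) → ℝ} {G G' : (𝔼 N) → 𝔼 N}
    (h : HasWeakGradient Ω u G) (h' : HasWeakGradient Ω u' G') :
    HasWeakGradient Ω (fun x => u x + u' x) (fun x => G x + G' x) := by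
  refine ⟨h.1.add h'.1, h.2.1.add h'.2.1, fun φ hφ => ?_⟩
  simp only [add_smul, smul_add]
  rw [integral_add (h.integrableOn_left hΩ hφ) (h'.integrableOn_left hΩ hφ),
    integral_add (h.integrableOn_right hΩ hφ) (h'.integrableOn_right hΩ hφ), h.2.2 φ hφ,
    h'.2.2 φ hφ]
  abel

lemma HasWeakGradient.const_mul {u : (𝔼 N) → ℝ} {G : (𝔼 N) → 𝔼 N}
    (h : HasWeakGradient Ω u G) (c : ℝ) :
    HasWeakGradient Ω (fun x => c * u x) (fun x => c • G x) := by
  refine ⟨h.1.smul c, h.2.1.smul c, fun φ hφ => ?_⟩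
  have h1 : ∀ x, (c * u x) • gradient φ x = c • (u x • gradient φ x) := fun x => mul_smul _ _ _
  have h2 : ∀ x, φ x • c • G x = c • (φ x • G x) := fun x => smul_comm _ _ _
  simp only [h1, h2]
  rw [integral_smul, integral_smul, h.2.2 φ hφ, smul_neg]

lemma HasWeakGradient.sub (hΩ : IsOpen Ω) {u u' : (𝔼 N) → ℝ} {G G' : (𝔼 N) → 𝔼 N}
    (h : HasWeakGradient Ω u G) (h' : HasWeakGradient Ω u' G') :
    HasWeakGradient Ω (fun x => u x - u' x) (fun x => G x - G' x) := by
  have := h.add hΩ (h'.const_mul (-1))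
  simpa [sub_eq_add_neg] using this

lemma HasWeakGradient.smooth_mul (hΩ : IsOpen Ω) {u η : (𝔼 N) → ℝ} {G : (𝔼 N) → 𝔼 N}
    (h : HasWeakGradient Ω u G) (hη : ContDiff ℝ ∞ η) :
    HasWeakGradient Ω (fun x => η x * u x) (fun x => η x • G x + u x • gradient η x) := by
  have hη' : Continuous (gradient η) := continuous_gradient (hη.of_le (by simp))
  have l1 : LocallyIntegrableOn (fun x => η x * u x) Ω :=
    h.1.continuousOn_mul hη.continuous.continuousOn hΩ.isLocallyClosed
  have l2 : LocallyIntegrableOn (fun x => η x • G x) Ω :=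
    h.2.1.continuousOn_smul hΩ.isLocallyClosed hη.continuous.continuousOn
  have l3 : LocallyIntegrableOn (fun x => u x • gradient η x) Ω :=
    h.1.smul_continuousOn hΩ.isLocallyClosed hη'.continuousOn
  refine ⟨l1, l2.add l3, fun φ hφ => ?_⟩
  -- The product rule is moved onto the test function: `u` is tested with `η φ`, and the extra term
  -- `u φ ∇η` goes to the other side.
  have hηφ := hφ.smooth_mul hη
  have key := h.2.2 _ hηφ
  have hd : ∀ x, gradient (fun x => η x * φ x) x = η x • gradient φ x + φ x • gradient η x :=
    fun x => gradient_fun_mul (hη.differentiable (by simp) x) (hφ.1.differentiable (by simp) x)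
  have hi1 : IntegrableOn (fun x => u x • (φ x • gradient η x)) Ω :=
    integrableOn_smul_of_tsupport_subset' hΩ h.1 (hφ.1.continuous.smul hη')
      (hφ.2.1.smul_right) ((tsupport_smul_subset_left _ _).trans hφ.2.2)
  have hc2 : HasCompactSupport (fun x => η x • gradient φ x) :=
    HasCompactSupport.smul_left (f := η) hφ.gradient_hasCompactSupport
  have hs2 : tsupport (fun x => η x • gradient φ x) ⊆ Ω :=
    (closure_mono (Function.support_smul_subset_right η (gradient φ))).trans
      ((tsupport_gradient_subset φ).trans hφ.2.2)
  have hi2 : IntegrableOn (fun x => u x • (η x • gradient φ x)) Ω :=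
    integrableOn_smul_of_tsupport_subset' hΩ h.1 (hη.continuous.smul hφ.gradient_continuous)
      hc2 hs2
  have hi3 := h.integrableOn_right hΩ hηφ
  have e0 : ∫ x in Ω, u x • gradient (fun y => η y * φ y) x
      = (∫ x in Ω, u x • (η x • gradient φ x)) + ∫ x in Ω, u x • (φ x • gradient η x) := by
    rw [← integral_add hi2 hi1]
    exact integral_congr_ae (Eventually.of_forall fun x => by simp only [hd, smul_add])
  have e1 : ∫ x in Ω, (η x * u x) • gradient φ x = ∫ x in Ω, u x • (η x • gradient φ x) :=
    integral_congr_ae (Eventually.of_forall fun x => by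
      simp only [smul_smul, mul_comm])
  have e2 : ∫ x in Ω, φ x • (η x • G x + u x • gradient η x)
      = (∫ x in Ω, (η x * φ x) • G x) + ∫ x in Ω, u x • (φ x • gradient η x) := by
    rw [← integral_add hi3 hi1]
    exact integral_congr_ae (Eventually.of_forall fun x => by
      simp only [smul_add, smul_smul, mul_comm])
  rw [e1, e2, neg_add, ← key, e0, add_neg_cancel_right]

/-- Integration by parts for `C¹` functions. -/
lemma integral_smul_gradient_of_contDiff {w φ : (𝔼 N) → ℝ} (hw : ContDiff ℝ 1 w)
    (hφ : ContDiff ℝ 1 φ) (hc : HasCompactSupport φ) :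
    ∫ x, w x • gradient φ x = -∫ x, φ x • gradient w x := by
  have hwc := hw.continuous
  have hφc := hφ.continuous
  have hgw := continuous_gradient hw
  have hgφ := continuous_gradient hφ
  have hcg : HasCompactSupport (gradient φ) :=
    hc.mono' ((subset_tsupport _).trans (tsupport_gradient_subset φ))
  have i1 : Integrable (fun x => w x • gradient φ x) :=
    (hwc.smul hgφ).integrable_of_hasCompactSupport hcg.smul_left
  have i2 : Integrable (fun x => φ x • gradient w x) :=
    (hφc.smul hgw).integrable_of_hasCompactSupport hc.smul_right
  refine ext_inner_left ℝ fun e => ?_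
  rw [← integral_inner i1, inner_neg_right, ← integral_inner i2]
  have key := integral_mul_fderiv_eq_neg_fderiv_mul_of_integrable (μ := volume) (f := w) (g := φ)
    (v := e) ?_ ?_ ?_ (fun x _ => hw.differentiable one_ne_zero x)
    (fun x _ => hφ.differentiable one_ne_zero x)
  · have e1 : ∀ x, inner ℝ e (w x • gradient φ x) = w x * fderiv ℝ φ x e := fun x => by
      simp [inner_smul_right, inner_gradient_right]
    have e2 : ∀ x, inner ℝ e (φ x • gradient w x) = fderiv ℝ w x e * φ x := fun x => by
      simp [inner_smul_right, inner_gradient_right, mul_comm]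
    simp only [e1, e2]
    exact key
  · exact (((hw.continuous_fderiv one_ne_zero).clm_apply continuous_const).mul
      hφc).integrable_of_hasCompactSupport hc.mul_left
  · refine (hwc.mul ((hφ.continuous_fderiv one_ne_zero).clm_apply
      continuous_const)).integrable_of_hasCompactSupport ?_
    exact ((hc.fderiv_apply ℝ e)).mul_left
  · exact (hwc.mul hφc).integrable_of_hasCompactSupport hc.mul_left

lemma hasWeakGradient_of_contDiff {w : (𝔼 N) → ℝ} (hw : ContDiff ℝ 1 w) :
    HasWeakGradient Ω w (gradient w) := by
  refine ⟨hw.continuous.locallyIntegrable.locallyIntegrableOn _,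
    (continuous_gradient hw).locallyIntegrable.locallyIntegrableOn _, fun φ hφ => ?_⟩
  have h0 := integral_smul_gradient_of_contDiff hw (hφ.1.of_le (by simp)) hφ.2.1
  rw [setIntegral_eq_integral_of_forall_compl_eq_zero,
    setIntegral_eq_integral_of_forall_compl_eq_zero]
  · exact h0
  · intro x hx
    simp [image_eq_zero_of_notMem_tsupport (fun hh => hx (hφ.2.2 hh))]
  · intro x hx
    simp [gradient_eq_zero_of_notMem_tsupport (fun hh => hx (hφ.2.2 hh))]

end Basics

/-! ### Smooth approximation of compactly supported weakly differentiable functions. -/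

section Approximation

/-- If `gₙ → g` in `L¹` and `cₙ → c` boundedly a.e., then `cₙ gₙ → c g` in `L¹`. -/
lemma tendsto_lintegral_smul_sub_smul {α F : Type*} [MeasurableSpace α] {μ : Measure α}
    [NormedAddCommGroup F] [NormedSpace ℝ F] {c : ℕ → α → ℝ} {c₀ : α → ℝ} {g : ℕ → α → F}
    {g₀ : α → F} {C : ℝ} (hcm : ∀ n, AEStronglyMeasurable (c n) μ)
    (hcb : ∀ n, ∀ᵐ x ∂μ, |c n x| ≤ C)
    (hc : ∀ᵐ x ∂μ, Tendsto (fun n => c n x) atTop (𝓝 (c₀ x))) (hg₀ : Integrable g₀ μ)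
    (hg : Tendsto (fun n => ∫⁻ x, ‖g n x - g₀ x‖ₑ ∂μ) atTop (𝓝 0)) :
    Tendsto (fun n => ∫⁻ x, ‖c n x • g n x - c₀ x • g₀ x‖ₑ ∂μ) atTop (𝓝 0) := by
  have hc₀m : AEStronglyMeasurable c₀ μ := aestronglyMeasurable_of_tendsto_ae atTop hcm hc
  have hcb' : ∀ᵐ x ∂μ, ∀ n, |c n x| ≤ C := ae_all_iff.2 hcb
  have hc₀b : ∀ᵐ x ∂μ, |c₀ x| ≤ C := by
    filter_upwards [hc, hcb'] with x hx hb
    exact le_of_tendsto hx.abs (Eventually.of_forall hb)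
  have h1 : Tendsto (fun n => ∫⁻ x, ENNReal.ofReal C * ‖g n x - g₀ x‖ₑ ∂μ) atTop (𝓝 0) := by
    simp_rw [lintegral_const_mul' _ _ ENNReal.ofReal_ne_top]
    simpa using ENNReal.Tendsto.const_mul hg (Or.inr ENNReal.ofReal_ne_top)
  have h2 : Tendsto (fun n => ∫⁻ x, ‖(c n x - c₀ x) • g₀ x‖ₑ ∂μ) atTop (𝓝 0) := by
    have := tendsto_lintegral_of_dominated_convergence' (μ := μ)
      (F := fun n x => ‖(c n x - c₀ x) • g₀ x‖ₑ) (f := fun _ => 0)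
      (fun x => ENNReal.ofReal (2 * C) * ‖g₀ x‖ₑ)
      (fun n => (((hcm n).sub hc₀m).smul hg₀.aestronglyMeasurable).enorm) ?_ ?_ ?_
    · simpa using this
    · intro n
      filter_upwards [hcb n, hc₀b] with x hx hx0
      rw [enorm_smul]
      gcongr
      rw [Real.enorm_eq_ofReal_abs]
      apply ENNReal.ofReal_le_ofReal
      calc |c n x - c₀ x| ≤ |c n x| + |c₀ x| := abs_sub _ _
        _ ≤ 2 * C := by linarith
    · rw [lintegral_const_mul' _ _ ENNReal.ofReal_ne_top]
      exact ENNReal.mul_ne_top ENNReal.ofReal_ne_top hg₀.2.ne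
    · filter_upwards [hc] with x hx
      have : Tendsto (fun n => ‖(c n x - c₀ x) • g₀ x‖ₑ) atTop (𝓝 ‖(c₀ x - c₀ x) • g₀ x‖ₑ) :=
        ((hx.sub_const _).smul_const _).enorm
      simpa using this
  have h12 := h1.add h2
  rw [add_zero] at h12
  refine tendsto_of_tendsto_of_tendsto_of_le_of_le tendsto_const_nhds h12 (fun _ => zero_le) ?_
  intro n
  have hm : AEMeasurable (fun x => ‖(c n x - c₀ x) • g₀ x‖ₑ) μ :=
    (((hcm n).sub hc₀m).smul hg₀.aestronglyMeasurable).enorm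
  dsimp only
  rw [← lintegral_add_right' _ hm]
  apply lintegral_mono_ae
  filter_upwards [hcb n] with x hx
  -- The first summand is small by boundedness of the coefficients, the second by dominated
  -- convergence.
  have : c n x • g n x - c₀ x • g₀ x = c n x • (g n x - g₀ x) + (c n x - c₀ x) • g₀ x := by
    rw [smul_sub, sub_smul]; abel
  rw [this]
  refine (enorm_add_le _ _).trans ?_
  gcongr
  rw [enorm_smul]
  gcongr
  rw [Real.enorm_eq_ofReal_abs]
  exact ENNReal.ofReal_le_ofReal hx

lemma exists_contDiff_cutoff {E : Type*} [NormedAddCommGroup E] [NormedSpace ℝ E]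
    [FiniteDimensional ℝ E] {U K : Set E} (hU : IsOpen U) (hK : IsCompact K) (hKU : K ⊆ U) :
    ∃ η : E → ℝ, ContDiff ℝ ∞ η ∧ HasCompactSupport η ∧ tsupport η ⊆ U ∧
      ∀ x ∈ K, η =ᶠ[𝓝 x] fun _ => 1 := by
  obtain ⟨L, hL, hKL, hLU⟩ := exists_compact_between hK hU hKU
  obtain ⟨f, hf1, hf0, -⟩ := exists_contMDiffMap_one_nhds_of_subset_interior
    (n := (⊤ : ℕ∞)) (modelWithCornersSelf ℝ E) hK.isClosed hKL
  have hs : tsupport f ⊆ L := closure_minimal (fun x hx => by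
    by_contra h
    exact hx (hf0 x h)) hL.isClosed
  exact ⟨f, f.contMDiff.contDiff, hL.of_isClosed_subset (isClosed_tsupport _) hs,
    hs.trans hLU, fun x hx => hf1.filter_mono (nhds_le_nhdsSet hx)⟩

lemma exists_cutoff (hΩ : IsOpen Ω) {K : Set (𝔼 N)} (hK : IsCompact K) (hKΩ : K ⊆ Ω) :
    ∃ η : (𝔼 N) → ℝ, IsTestFunction Ω η ∧ ∀ x ∈ K, η =ᶠ[𝓝 x] fun _ => 1 := by
  obtain ⟨η, h1, h2, h3, h4⟩ := exists_contDiff_cutoff hΩ hK hKΩ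
  exact ⟨η, ⟨h1, h2, h3⟩, h4⟩

section Compact

variable {u : (𝔼 N) → ℝ} {H : (𝔼 N) → 𝔼 N} {K : Set (𝔼 N)}

/-- Extension by zero keeps the weak gradient on the whole space. Any smooth `ζ` may be tested,
since multiplying it by a cutoff equal to `1` near `K` changes neither side. -/
lemma integral_indicator_smul_gradient (hΩ : IsOpen Ω) (h : HasWeakGradient Ω u H)
    (hK : IsCompact K) (hKΩ : K ⊆ Ω) (hu : ∀ᵐ x ∂volume.restrict Ω, x ∉ K → u x = 0)
    (hH : ∀ᵐ x ∂volume.restrict Ω, x ∉ K → H x = 0) {ζ : (𝔼 N) → ℝ} (hζ : ContDiff ℝ ∞ ζ) :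
    ∫ x, K.indicator u x • gradient ζ x = -∫ x, ζ x • K.indicator H x := by
  obtain ⟨η, hη, hη1⟩ := exists_cutoff hΩ hK hKΩ
  have key := h.2.2 _ (hη.smooth_mul hζ)
  have e1 : ∫ x in Ω, u x • gradient (fun y => ζ y * η y) x
      = ∫ x, K.indicator u x • gradient ζ x := by
    rw [← setIntegral_eq_integral_of_forall_compl_eq_zero (s := Ω)
      (f := fun x => K.indicator u x • gradient ζ x)]
    · apply integral_congr_ae
      filter_upwards [hu] with x hx
      by_cases hxK : x ∈ K
      · have : (fun y => ζ y * η y) =ᶠ[𝓝 x] ζ := by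
          filter_upwards [hη1 x hxK] with y hy
          simp [hy]
        simp [hxK, this.gradient_eq]
      · simp [hxK, hx hxK]
    · intro x hx
      simp [show x ∉ K from fun hh => hx (hKΩ hh)]
  have e2 : ∫ x in Ω, (ζ x * η x) • H x = ∫ x, ζ x • K.indicator H x := by
    rw [← setIntegral_eq_integral_of_forall_compl_eq_zero (s := Ω)
      (f := fun x => ζ x • K.indicator H x)]
    · apply integral_congr_ae
      filter_upwards [hH] with x hx
      by_cases hxK : x ∈ K
      · simp [hxK, (hη1 x hxK).self_of_nhds]
      · simp [hxK, hx hxK]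
    · intro x hx
      simp [show x ∉ K from fun hh => hx (hKΩ hh)]
  rw [← e1, ← e2, key]

/-- The derivative of a convolution falls on the kernel, and `y ↦ ρ (x - y)` is then used as the
test function. The reflection contributes a minus sign that cancels the one from integration by
parts. -/
lemma gradient_mollify {U : (𝔼 N) → ℝ} {V : (𝔼 N) → 𝔼 N} (hU : Integrable U)
    (hV : Integrable V)
    (h : ∀ ζ : (𝔼 N) → ℝ, ContDiff ℝ ∞ ζ → ∫ x, U x • gradient ζ x = -∫ x, ζ x • V x)
    {ρ : (𝔼 N) → ℝ} (hρ : ContDiff ℝ ∞ ρ) (hc : HasCompactSupport ρ) (x : 𝔼 N) :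
    gradient (fun x => ∫ t, ρ t • U (x - t)) x = ∫ t, ρ t • V (x - t) := by
  have hW : (fun x => ∫ t, ρ t • U (x - t))
      = (MeasureTheory.convolution U ρ (ContinuousLinearMap.lsmul ℝ ℝ) volume) := by
    ext x
    rw [convolution_lsmul, ← integral_sub_left_eq_self _ volume x]
    simp [mul_comm]
  have hfd := hc.hasFDerivAt_convolution_right (ContinuousLinearMap.lsmul ℝ ℝ)
    hU.locallyIntegrable (hρ.of_le (by simp)) x
  have hρc : Continuous ρ := hρ.continuous
  refine ext_inner_left ℝ fun e => ?_
  rw [hW, inner_gradient_right, hfd.fderiv, convolution_precompR_apply _ hU.locallyIntegrable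
    (hc.fderiv ℝ) (hρ.continuous_fderiv (by simp)), convolution_lsmul]
  have hζ : ContDiff ℝ ∞ (fun y => ρ (x - y)) := hρ.comp (contDiff_const.sub contDiff_id)
  have hg : ∀ y, gradient (fun y => ρ (x - y)) y = -gradient ρ (x - y) := by
    intro y
    have hd : HasFDerivAt (fun y => ρ (x - y))
        ((fderiv ℝ ρ (x - y)).comp (-(ContinuousLinearMap.id ℝ (𝔼 N)))) y :=
      (hρ.differentiable (by simp) (x - y)).hasFDerivAt.comp y ((hasFDerivAt_id y).const_sub x)
    simp [gradient, hd.fderiv]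
  have hgi : Integrable (fun y => U y • gradient (fun y => ρ (x - y)) y) := by
    have hgc : Continuous (gradient ρ) := continuous_gradient (hρ.of_le (by simp))
    have hgs : HasCompactSupport (gradient ρ) :=
      hc.mono' ((subset_tsupport _).trans (tsupport_gradient_subset ρ))
    obtain ⟨C, hC⟩ := hgs.exists_bound_of_continuous hgc
    simp only [hg]
    exact hU.smul_bdd C (hgc.comp (continuous_const.sub continuous_id)).neg.aestronglyMeasurable
      (Eventually.of_forall fun y => by simpa using hC (x - y))
  have hVi : Integrable (fun y => ρ (x - y) • V y) := by
    obtain ⟨C, hC⟩ := hc.exists_bound_of_continuous hρc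
    exact hV.bdd_smul C (hρc.comp (continuous_const.sub continuous_id)).aestronglyMeasurable
      (Eventually.of_forall fun y => by simpa using hC (x - y))
  have e1 : (∫ t, ρ t • V (x - t)) = ∫ y, ρ (x - y) • V y := by
    rw [← integral_sub_left_eq_self _ volume x]
    simp
  have e2 : ∀ y, U y • fderiv ℝ ρ (x - y) e
      = -inner ℝ e (U y • gradient (fun y => ρ (x - y)) y) := fun y => by
    rw [hg, inner_smul_right, inner_neg_right, inner_gradient_right]
    simp
  rw [e1]
  simp only [e2]
  rw [integral_neg, integral_inner hgi, h _ hζ, inner_neg_right]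
  simp

/-- A compactly supported function with a weak gradient is a limit of test functions
in `W^{1,1}`. -/
lemma HasWeakGradient.exists_testFunction_tendsto (hΩ : IsOpen Ω) (h : HasWeakGradient Ω u H)
    (hK : IsCompact K) (hKΩ : K ⊆ Ω) (hu : ∀ᵐ x ∂volume.restrict Ω, x ∉ K → u x = 0)
    (hH : ∀ᵐ x ∂volume.restrict Ω, x ∉ K → H x = 0) :
    ∃ φ : ℕ → (𝔼 N) → ℝ, (∀ n, IsTestFunction Ω (φ n)) ∧
      Tendsto (fun n => ∫⁻ x in Ω, ‖φ n x - u x‖ₑ) atTop (𝓝 0) ∧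
      Tendsto (fun n => ∫⁻ x in Ω, ‖gradient (φ n) x - H x‖ₑ) atTop (𝓝 0) := by
  have hU : Integrable (K.indicator u) :=
    (integrable_indicator_iff hK.measurableSet).2 (h.1.integrableOn_compact_subset hKΩ hK)
  have hV : Integrable (K.indicator H) :=
    (integrable_indicator_iff hK.measurableSet).2 (h.2.1.integrableOn_compact_subset hKΩ hK)
  have hUu : ∀ᵐ x ∂volume.restrict Ω, K.indicator u x = u x := by
    filter_upwards [hu] with x hx
    by_cases hxK : x ∈ K
    · simp [hxK]
    · simp [hxK, hx hxK]
  have hVH : ∀ᵐ x ∂volume.restrict Ω, K.indicator H x = H x := by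
    filter_upwards [hH] with x hx
    by_cases hxK : x ∈ K
    · simp [hxK]
    · simp [hxK, hx hxK]
  obtain ⟨δ, hδ, hδΩ⟩ := hK.exists_cthickening_subset_open hΩ hKΩ
  -- Outer radii `δ / (n + 1)` tend to zero and never exceed `δ`, so every mollification is
  -- supported in the closed `δ`-thickening of `K`, still inside `Ω`.
  let ψ : ℕ → ContDiffBump (0 : 𝔼 N) := fun n =>
    ⟨δ / (n + 1) / 2, δ / (n + 1), by positivity, by
      have : 0 < δ / (n + 1) := by positivity
      linarith⟩
  have hψ : Tendsto (fun n => (ψ n).rOut) atTop (𝓝 0) :=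
    tendsto_const_div_atTop_nhds_zero_nat δ |>.comp (tendsto_add_atTop_nat 1) |>.congr
      fun n => by simp [ψ]
  have hψδ : ∀ n, (ψ n).rOut ≤ δ := fun n => by
    have : δ / ((n : ℝ) + 1) ≤ δ := div_le_self hδ.le (by linarith [n.cast_nonneg (α := ℝ)])
    exact this
  let φ : ℕ → (𝔼 N) → ℝ := fun n x => ∫ t, (ψ n).normed volume t • K.indicator u (x - t)
  have hφeq : ∀ n, φ n = MeasureTheory.convolution ((ψ n).normed volume) (K.indicator u)
      (ContinuousLinearMap.lsmul ℝ ℝ) volume := fun n => rfl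
  have hts : ∀ n, tsupport (φ n) ⊆ Metric.cthickening δ K := by
    intro n
    refine closure_minimal ?_ Metric.isClosed_cthickening
    rw [hφeq]
    refine (support_convolution_subset_swap _).trans ?_
    rw [(ψ n).support_normed_eq]
    rintro _ ⟨a, ha, b, hb, rfl⟩
    have haK : a ∈ K := by
      by_contra hh
      exact ha (by simp [hh])
    refine Metric.mem_cthickening_of_dist_le _ a _ _ haK ?_
    have : dist b 0 < (ψ n).rOut := hb
    rw [dist_zero_right] at this
    simpa [dist_eq_norm] using this.le.trans (hψδ n)
  refine ⟨φ, fun n => ⟨?_, ?_, (hts n).trans hδΩ⟩, ?_, ?_⟩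
  · rw [hφeq]
    exact (ψ n).hasCompactSupport_normed.contDiff_convolution_left (n := ⊤) _
      (ψ n).contDiff_normed hU.locallyIntegrable
  · exact hK.cthickening.of_isClosed_subset (isClosed_tsupport _) (hts n)
  · have := tendsto_lintegral_mollify_sub hU hψ
    refine tendsto_of_tendsto_of_tendsto_of_le_of_le tendsto_const_nhds this
      (fun _ => zero_le) fun n => ?_
    refine le_trans (le_of_eq ?_) (setLIntegral_le_lintegral Ω _)
    apply lintegral_congr_ae
    filter_upwards [hUu] with x hx
    rw [hx]
  · have := tendsto_lintegral_mollify_sub hV hψ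
    refine tendsto_of_tendsto_of_tendsto_of_le_of_le tendsto_const_nhds this
      (fun _ => zero_le) fun n => ?_
    refine le_trans (le_of_eq ?_) (setLIntegral_le_lintegral Ω _)
    apply lintegral_congr_ae
    filter_upwards [hVH] with x hx
    rw [hx, gradient_mollify hU hV (fun ζ hζ =>
      integral_indicator_smul_gradient hΩ h hK hKΩ hu hH hζ) (ψ n).contDiff_normed
      (ψ n).hasCompactSupport_normed]

end Compact

end Approximation

/-! ### Chain rule for `C¹` functions of two variables. -/

section ChainRule

lemma exists_subseq_tendsto_ae {α F : Type*} [MeasurableSpace α] {μ : Measure α}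
    [NormedAddCommGroup F] {g : ℕ → α → F} {g₀ : α → F}
    (hm : ∀ n, AEStronglyMeasurable (g n) μ) (hm₀ : AEStronglyMeasurable g₀ μ)
    (hg : Tendsto (fun n => ∫⁻ x, ‖g n x - g₀ x‖ₑ ∂μ) atTop (𝓝 0)) :
    ∃ ns : ℕ → ℕ, StrictMono ns ∧
      ∀ᵐ x ∂μ, Tendsto (fun i => g (ns i) x) atTop (𝓝 (g₀ x)) := by
  refine TendstoInMeasure.exists_seq_tendsto_ae (tendstoInMeasure_of_tendsto_eLpNorm
    one_ne_zero hm hm₀ ?_)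
  simpa only [eLpNorm_one_eq_lintegral_enorm, Pi.sub_apply] using hg

variable {u u₁ u₂ : (𝔼 N) → ℝ} {G G₁ G₂ : (𝔼 N) → 𝔼 N}

lemma abs_sub_le_of_fderiv_le {F : ℝ × ℝ → ℝ} (hF : ContDiff ℝ 1 F) {C : ℝ}
    (hC : ∀ z, ‖fderiv ℝ F z‖ ≤ C) (a b a' b' : ℝ) :
    |F (a, b) - F (a', b')| ≤ C * (|a - a'| + |b - b'|) := by
  have h0 : 0 ≤ C := (norm_nonneg _).trans (hC 0)
  have h1 := Convex.norm_image_sub_le_of_norm_fderiv_le (𝕜 := ℝ) (f := F) (s := Set.univ)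
    (x := (a', b')) (y := (a, b)) (fun z _ => hF.differentiable one_ne_zero z) (fun z _ => hC z)
    convex_univ trivial trivial
  rw [Real.norm_eq_abs] at h1
  refine h1.trans (mul_le_mul_of_nonneg_left ?_ h0)
  rw [Prod.mk_sub_mk, Prod.norm_mk]
  exact max_le (by simp) (by simp)

lemma gradient_comp_prodMk {F : ℝ × ℝ → ℝ} (hF : ContDiff ℝ 1 F) {a b : (𝔼 N) → ℝ}
    (ha : ContDiff ℝ 1 a) (hb : ContDiff ℝ 1 b) (x : 𝔼 N) :
    gradient (fun y => F (a y, b y)) x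
      = fderiv ℝ F (a x, b x) (1, 0) • gradient a x
        + fderiv ℝ F (a x, b x) (0, 1) • gradient b x := by
  have hda := (ha.differentiable one_ne_zero x).hasFDerivAt
  have hdb := (hb.differentiable one_ne_zero x).hasFDerivAt
  have hd := (hF.differentiable one_ne_zero (a x, b x)).hasFDerivAt.comp x (hda.prodMk hdb)
  refine ext_inner_right ℝ fun e => ?_
  have hd' : fderiv ℝ (fun y => F (a y, b y)) x
      = (fderiv ℝ F (a x, b x)).comp ((fderiv ℝ a x).prod (fderiv ℝ b x)) := hd.fderiv
  rw [inner_gradient_left, hd', inner_add_left, inner_smul_left, inner_smul_left,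
    inner_gradient_left, inner_gradient_left]
  have : ((fderiv ℝ a x) e, (fderiv ℝ b x) e)
      = (fderiv ℝ a x) e • ((1 : ℝ), (0 : ℝ)) + (fderiv ℝ b x) e • ((0 : ℝ), (1 : ℝ)) := by simp
  simp only [ContinuousLinearMap.comp_apply, ContinuousLinearMap.prod_apply]
  rw [this, map_add, map_smul, map_smul]
  simp [mul_comm]

lemma integrable_comp_prodMk {α : Type*} [MeasurableSpace α] {μ : Measure α} [IsFiniteMeasure μ]
    {F : ℝ × ℝ → ℝ} (hF : ContDiff ℝ 1 F) {C : ℝ} (hC : ∀ z, ‖fderiv ℝ F z‖ ≤ C)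
    {a b : α → ℝ} (ha : Integrable a μ) (hb : Integrable b μ) :
    Integrable (fun x => F (a x, b x)) μ := by
  have hm : AEStronglyMeasurable (fun x => F (a x, b x)) μ :=
    hF.continuous.comp_aestronglyMeasurable (ha.1.prodMk hb.1)
  refine (((ha.abs.add hb.abs).const_mul C).add (integrable_const |F (0, 0)|)).mono' hm
    (Eventually.of_forall fun x => ?_)
  have := abs_sub_le_of_fderiv_le hF hC (a x) (b x) 0 0
  simp only [sub_zero] at this
  simp only [Pi.add_apply, Real.norm_eq_abs]
  have h2 := abs_sub_abs_le_abs_sub (F (a x, b x)) (F (0, 0))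
  linarith

lemma norm_fderiv_apply_le {F : ℝ × ℝ → ℝ} {C : ℝ} (hC : ∀ z, ‖fderiv ℝ F z‖ ≤ C) (z : ℝ × ℝ) :
    |fderiv ℝ F z (1, 0)| ≤ C ∧ |fderiv ℝ F z (0, 1)| ≤ C := by
  constructor
  · have := (fderiv ℝ F z).le_opNorm (1, 0)
    simp only [Prod.norm_mk, norm_one, norm_zero, Real.norm_eq_abs] at this
    exact this.trans (by simpa using hC z)
  · have := (fderiv ℝ F z).le_opNorm (0, 1)
    simp only [Prod.norm_mk, norm_one, norm_zero, Real.norm_eq_abs] at this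
    exact this.trans (by simpa using hC z)

/-- Chain rule for the composition of a `C¹` function of two variables having bounded derivative
with two weakly differentiable functions. -/
lemma HasWeakGradient.comp_prodMk (hΩ : IsOpen Ω) (h₁ : HasWeakGradient Ω u₁ G₁)
    (h₂ : HasWeakGradient Ω u₂ G₂) {F : ℝ × ℝ → ℝ} (hF : ContDiff ℝ 1 F) {C : ℝ}
    (hC : ∀ z, ‖fderiv ℝ F z‖ ≤ C) :
    HasWeakGradient Ω (fun x => F (u₁ x, u₂ x))
      (fun x => fderiv ℝ F (u₁ x, u₂ x) (1, 0) • G₁ x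
        + fderiv ℝ F (u₁ x, u₂ x) (0, 1) • G₂ x) := by
  have hd1 : Continuous fun z => fderiv ℝ F z (1, 0) :=
    (hF.continuous_fderiv one_ne_zero).clm_apply continuous_const
  have hd2 : Continuous fun z => fderiv ℝ F z (0, 1) :=
    (hF.continuous_fderiv one_ne_zero).clm_apply continuous_const
  refine ⟨?_, ?_, fun φ hφ => ?_⟩
  · rw [locallyIntegrableOn_iff hΩ.isLocallyClosed]
    intro K hK hc
    have : IsFiniteMeasure (volume.restrict K) := ⟨by simpa using hc.measure_lt_top⟩
    exact integrable_comp_prodMk hF hC (h₁.1.integrableOn_compact_subset hK hc)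
      (h₂.1.integrableOn_compact_subset hK hc)
  · rw [locallyIntegrableOn_iff hΩ.isLocallyClosed]
    intro K hK hc
    have i1 := h₁.1.integrableOn_compact_subset hK hc
    have i2 := h₂.1.integrableOn_compact_subset hK hc
    have hm := i1.1.prodMk i2.1
    exact ((h₁.2.1.integrableOn_compact_subset hK hc).bdd_smul C
        (hd1.comp_aestronglyMeasurable hm)
        (Eventually.of_forall fun x => (norm_fderiv_apply_le hC _).1)).add
      ((h₂.2.1.integrableOn_compact_subset hK hc).bdd_smul C (hd2.comp_aestronglyMeasurable hm)
        (Eventually.of_forall fun x => (norm_fderiv_apply_le hC _).2))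
  -- Only values near the support of `φ` matter, so `u₁`, `u₂` are replaced by `η u₁`, `η u₂`, which
  -- are compactly supported and hence limits of test functions `a`, `b`. The classical rule for `F
  -- (a, b)` then passes to the limit.
  · obtain ⟨η, hη, hη1⟩ := exists_cutoff hΩ hφ.2.1 hφ.2.2
    have hw₁ := h₁.smooth_mul hΩ hη.1
    have hw₂ := h₂.smooth_mul hΩ hη.1
    set w₁ := fun x => η x * u₁ x
    set w₂ := fun x => η x * u₂ x
    set W₁ := fun x => η x • G₁ x + u₁ x • gradient η x
    set W₂ := fun x => η x • G₂ x + u₂ x • gradient η x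
    have z₁ : ∀ x, x ∉ tsupport η → w₁ x = 0 := fun x hx => by
      simp [w₁, image_eq_zero_of_notMem_tsupport hx]
    have z₂ : ∀ x, x ∉ tsupport η → w₂ x = 0 := fun x hx => by
      simp [w₂, image_eq_zero_of_notMem_tsupport hx]
    have Z₁ : ∀ x, x ∉ tsupport η → W₁ x = 0 := fun x hx => by
      simp [W₁, image_eq_zero_of_notMem_tsupport hx, gradient_eq_zero_of_notMem_tsupport hx]
    have Z₂ : ∀ x, x ∉ tsupport η → W₂ x = 0 := fun x hx => by
      simp [W₂, image_eq_zero_of_notMem_tsupport hx, gradient_eq_zero_of_notMem_tsupport hx]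
    have iw₁ : IntegrableOn w₁ Ω := IntegrableOn.of_forall_sdiff_eq_zero
      (hw₁.1.integrableOn_compact_subset hη.2.2 hη.2.1) hΩ.measurableSet fun x hx => z₁ x hx.2
    have iw₂ : IntegrableOn w₂ Ω := IntegrableOn.of_forall_sdiff_eq_zero
      (hw₂.1.integrableOn_compact_subset hη.2.2 hη.2.1) hΩ.measurableSet fun x hx => z₂ x hx.2
    have iW₁ : IntegrableOn W₁ Ω := IntegrableOn.of_forall_sdiff_eq_zero
      (hw₁.2.1.integrableOn_compact_subset hη.2.2 hη.2.1) hΩ.measurableSet fun x hx => Z₁ x hx.2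
    have iW₂ : IntegrableOn W₂ Ω := IntegrableOn.of_forall_sdiff_eq_zero
      (hw₂.2.1.integrableOn_compact_subset hη.2.2 hη.2.1) hΩ.measurableSet fun x hx => Z₂ x hx.2
    obtain ⟨a, ha, hal, haG⟩ := hw₁.exists_testFunction_tendsto hΩ hη.2.1 hη.2.2
      (Eventually.of_forall z₁) (Eventually.of_forall Z₁)
    obtain ⟨b, hb, hbl, hbG⟩ := hw₂.exists_testFunction_tendsto hΩ hη.2.1 hη.2.2
      (Eventually.of_forall z₂) (Eventually.of_forall Z₂)
    obtain ⟨ns, hns, hnsa⟩ := exists_subseq_tendsto_ae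
      (fun n => (ha n).1.continuous.aestronglyMeasurable) iw₁.1 hal
    obtain ⟨ms, hms, hmsb⟩ := exists_subseq_tendsto_ae
      (fun n => (hb (ns n)).1.continuous.aestronglyMeasurable) iw₂.1
      (hbl.comp hns.tendsto_atTop)
    set k : ℕ → ℕ := fun n => ns (ms n)
    have hk : Tendsto k atTop atTop := hns.tendsto_atTop.comp hms.tendsto_atTop
    have hka : ∀ᵐ x ∂volume.restrict Ω, Tendsto (fun n => a (k n) x) atTop (𝓝 (w₁ x)) :=
      hnsa.mono fun x hx => hx.comp hms.tendsto_atTop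
    have hkb : ∀ᵐ x ∂volume.restrict Ω, Tendsto (fun n => b (k n) x) atTop (𝓝 (w₂ x)) := hmsb
    have ca : ∀ n, ContDiff ℝ 1 (a n) := fun n => (ha n).1.of_le (by simp)
    have cb : ∀ n, ContDiff ℝ 1 (b n) := fun n => (hb n).1.of_le (by simp)
    obtain ⟨M, hM⟩ := hφ.gradient_hasCompactSupport.exists_bound_of_continuous
      hφ.gradient_continuous
    obtain ⟨M', hM'⟩ := hφ.2.1.exists_bound_of_continuous hφ.1.continuous
    have hM0 : 0 ≤ M := (norm_nonneg _).trans (hM 0)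
    have hM0' : 0 ≤ M' := (norm_nonneg _).trans (hM' 0)
    have hC0 : 0 ≤ C := (norm_nonneg _).trans (hC 0)
    have hmw := iw₁.1.prodMk iw₂.1
    -- `F` is Lipschitz, so `L¹` convergence of `a` and `b` suffices here.
    have L : Tendsto (fun n => ∫ x in Ω, F (a (k n) x, b (k n) x) • gradient φ x) atTop
        (𝓝 (∫ x in Ω, F (w₁ x, w₂ x) • gradient φ x)) := by
      refine tendsto_integral_of_L1 (fun x => F (w₁ x, w₂ x) • gradient φ x) ((hF.continuous.comp_aestronglyMeasurable hmw).smul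
        hφ.gradient_continuous.aestronglyMeasurable) (Eventually.of_forall fun n => ?_) ?_
      · exact (((hF.continuous.comp ((ha _).1.continuous.prodMk (hb _).1.continuous)).smul
          hφ.gradient_continuous).integrable_of_hasCompactSupport
            (HasCompactSupport.smul_left (f := fun x => F (a (k n) x, b (k n) x))
              hφ.gradient_hasCompactSupport)).integrableOn
      · have h0 : Tendsto (fun n => ENNReal.ofReal (C * M) *
            ((∫⁻ x in Ω, ‖a (k n) x - w₁ x‖ₑ) + ∫⁻ x in Ω, ‖b (k n) x - w₂ x‖ₑ)) atTop (𝓝 0) := by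
          have := ENNReal.Tendsto.const_mul (a := ENNReal.ofReal (C * M))
            ((hal.comp hk).add (hbl.comp hk)) (Or.inr ENNReal.ofReal_ne_top)
          simpa using this
        refine tendsto_of_tendsto_of_tendsto_of_le_of_le tendsto_const_nhds h0
          (fun _ => zero_le) fun n => ?_
        have hmm : AEMeasurable (fun x => ‖a (k n) x - w₁ x‖ₑ) (volume.restrict Ω) :=
          ((ha _).1.continuous.aestronglyMeasurable.sub iw₁.1).enorm
        dsimp only
        rw [← lintegral_add_left' hmm, ← lintegral_const_mul' _ _ ENNReal.ofReal_ne_top]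
        apply lintegral_mono
        intro x
        dsimp only
        rw [← sub_smul, ← ofReal_norm, ← ofReal_norm, ← ofReal_norm,
          ← ENNReal.ofReal_add (norm_nonneg _) (norm_nonneg _),
          ← ENNReal.ofReal_mul (mul_nonneg hC0 hM0), norm_smul]
        apply ENNReal.ofReal_le_ofReal
        calc _ ≤ (C * (|a (k n) x - w₁ x| + |b (k n) x - w₂ x|)) * M :=
              mul_le_mul (abs_sub_le_of_fderiv_le hF hC _ _ _ _) (hM x) (norm_nonneg _)
                (by positivity)
          _ = _ := by simp only [Real.norm_eq_abs]; ring
    -- The coefficients `D (a, b)` converge only almost everywhere, but boundedly, while the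
    -- gradients converge in `L¹`; this is why an a.e. convergent subsequence `k` was extracted.
    have R : ∀ (D : ℝ × ℝ → ℝ) (W : (𝔼 N) → 𝔼 N) (c : ℕ → (𝔼 N) → ℝ), Continuous D →
        (∀ z, |D z| ≤ C) → IntegrableOn W Ω → (∀ n, IsTestFunction Ω (c n)) →
        Tendsto (fun n => ∫⁻ x in Ω, ‖gradient (c n) x - W x‖ₑ) atTop (𝓝 0) →
        Tendsto (fun n => ∫ x in Ω, (φ x * D (a (k n) x, b (k n) x)) • gradient (c (k n)) x)
          atTop (𝓝 (∫ x in Ω, (φ x * D (w₁ x, w₂ x)) • W x)) := by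
      intro D W c hD hDC hW hc hcl
      refine tendsto_integral_of_L1 _ ((hφ.1.continuous.aestronglyMeasurable.mul
        (hD.comp_aestronglyMeasurable hmw)).smul hW.1) (Eventually.of_forall fun n => ?_) ?_
      · exact (((hφ.1.continuous.mul (hD.comp ((ha _).1.continuous.prodMk
          (hb _).1.continuous))).smul (hc _).gradient_continuous).integrable_of_hasCompactSupport
          (HasCompactSupport.smul_left (f := fun x => φ x * D (a (k n) x, b (k n) x))
              (hc _).gradient_hasCompactSupport)).integrableOn
      · refine tendsto_lintegral_smul_sub_smul (C := M' * C)
          (c := fun n x => φ x * D (a (k n) x, b (k n) x))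
          (c₀ := fun x => φ x * D (w₁ x, w₂ x)) (g := fun n x => gradient (c (k n)) x)
          (fun n => ?_) (fun n => ?_) ?_ hW (hcl.comp hk)
        · exact (hφ.1.continuous.mul (hD.comp ((ha _).1.continuous.prodMk
            (hb _).1.continuous))).aestronglyMeasurable
        · refine Eventually.of_forall fun x => ?_
          rw [abs_mul]
          exact mul_le_mul (hM' x) (hDC _) (abs_nonneg _) hM0'
        · filter_upwards [hka, hkb] with x hx hx'
          exact ((hD.tendsto _).comp (hx.prodMk_nhds hx')).const_mul _
    have R₁ := R _ W₁ a hd1 (fun z => (norm_fderiv_apply_le hC z).1) iW₁ ha haG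
    have R₂ := R _ W₂ b hd2 (fun z => (norm_fderiv_apply_le hC z).2) iW₂ hb hbG
    have key : ∀ n, ∫ x in Ω, F (a (k n) x, b (k n) x) • gradient φ x
        = -((∫ x in Ω, (φ x * fderiv ℝ F (a (k n) x, b (k n) x) (1, 0)) • gradient (a (k n)) x)
          + ∫ x in Ω, (φ x * fderiv ℝ F (a (k n) x, b (k n) x) (0, 1)) • gradient (b (k n)) x) := by
      intro n
      have hw := (hasWeakGradient_of_contDiff (Ω := Ω)
        (w := fun x => F (a (k n) x, b (k n) x))
        (hF.comp ((ca (k n)).prodMk (cb (k n))))).2.2 φ hφ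
      rw [hw, ← integral_add]
      · congr 1
        refine integral_congr_ae (Eventually.of_forall fun x => ?_)
        have := gradient_comp_prodMk hF (ca (k n)) (cb (k n)) x
        simp only [this, smul_add, smul_smul]
      · exact (((hφ.1.continuous.mul (hd1.comp ((ha _).1.continuous.prodMk
          (hb _).1.continuous))).smul (ha _).gradient_continuous).integrable_of_hasCompactSupport
          (HasCompactSupport.smul_left (f := fun x => φ x * _)
              (ha _).gradient_hasCompactSupport)).integrableOn
      · exact (((hφ.1.continuous.mul (hd2.comp ((ha _).1.continuous.prodMk
          (hb _).1.continuous))).smul (hb _).gradient_continuous).integrable_of_hasCompactSupport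
          (HasCompactSupport.smul_left (f := fun x => φ x * _)
              (hb _).gradient_hasCompactSupport)).integrableOn
    have lim := tendsto_nhds_unique (L.congr key) (R₁.add R₂).neg
    have jm : ∀ (D : ℝ × ℝ → ℝ) (W : (𝔼 N) → 𝔼 N), Continuous D →
        (∀ z, |D z| ≤ C) → IntegrableOn W Ω →
        IntegrableOn (fun x => (φ x * D (w₁ x, w₂ x)) • W x) Ω := by
      intro D W hD hDC hW
      refine hW.bdd_smul (M' * C) (hφ.1.continuous.aestronglyMeasurable.mul
        (hD.comp_aestronglyMeasurable hmw)) (Eventually.of_forall fun x => ?_)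
      rw [Pi.mul_apply, norm_mul]
      exact mul_le_mul (hM' x) (hDC _) (abs_nonneg _) hM0'
    rw [← integral_add (jm _ W₁ hd1 (fun z => (norm_fderiv_apply_le hC z).1) iW₁)
      (jm _ W₂ hd2 (fun z => (norm_fderiv_apply_le hC z).2) iW₂)] at lim
    convert lim using 1
    · refine integral_congr_ae (Eventually.of_forall fun x => ?_)
      by_cases hx : x ∈ tsupport φ
      · simp [w₁, w₂, (hη1 x hx).self_of_nhds]
      · simp [gradient_eq_zero_of_notMem_tsupport hx]
    · congr 1
      refine integral_congr_ae (Eventually.of_forall fun x => ?_)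
      by_cases hx : x ∈ tsupport φ
      · have : gradient η x = 0 := by
          rw [(hη1 x hx).gradient_eq]; simp
        simp [w₁, w₂, W₁, W₂, (hη1 x hx).self_of_nhds, this, smul_smul]
      · simp [image_eq_zero_of_notMem_tsupport hx]

end ChainRule

/-! ### Absolute values, minima, and gradients on level sets. -/

section Lattice

variable {u u₁ u₂ : (𝔼 N) → ℝ} {G G₁ G₂ : (𝔼 N) → 𝔼 N}

/-- Chain rule for a `C¹` function of one variable with bounded derivative. -/
lemma HasWeakGradient.comp (hΩ : IsOpen Ω) (h : HasWeakGradient Ω u G) {F : ℝ → ℝ}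
    (hF : ContDiff ℝ 1 F) {C : ℝ} (hC : ∀ t, |deriv F t| ≤ C) :
    HasWeakGradient Ω (fun x => F (u x)) (fun x => deriv F (u x) • G x) := by
  have hfd : ∀ z : ℝ × ℝ, fderiv ℝ (fun z : ℝ × ℝ => F z.1) z
      = deriv F z.1 • ContinuousLinearMap.fst ℝ ℝ ℝ := fun z =>
    ((hF.differentiable one_ne_zero z.1).hasDerivAt.comp_hasFDerivAt z hasFDerivAt_fst).fderiv
  have := h.comp_prodMk hΩ h (F := fun z => F z.1) (hF.comp contDiff_fst) (C := C) fun z => by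
    rw [hfd, norm_smul]
    calc _ ≤ C * 1 := mul_le_mul (hC _) (ContinuousLinearMap.norm_fst_le ℝ ℝ ℝ)
          (norm_nonneg _) ((abs_nonneg _).trans (hC 0))
      _ = C := mul_one C
  simpa [hfd] using this

/-- Chain rule for a pointwise limit of `C¹` functions with uniformly bounded derivatives that
converge pointwise. -/
lemma HasWeakGradient.comp_of_tendsto (hΩ : IsOpen Ω) (h : HasWeakGradient Ω u G)
    {f : ℕ → ℝ → ℝ} {F g : ℝ → ℝ} {B C : ℝ} (hf : ∀ n, ContDiff ℝ 1 (f n))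
    (hB : ∀ n t, |f n t| ≤ B + C * |t|) (hC : ∀ n t, |deriv (f n) t| ≤ C)
    (hF : ∀ t, Tendsto (fun n => f n t) atTop (𝓝 (F t)))
    (hg : ∀ t, Tendsto (fun n => deriv (f n) t) atTop (𝓝 (g t))) :
    HasWeakGradient Ω (fun x => F (u x)) (fun x => g (u x) • G x) := by
  have hn := fun n => h.comp hΩ (hf n) (hC n)
  have hFm : Measurable F := measurable_of_tendsto_metrizable
    (fun n => (hf n).continuous.measurable) (tendsto_pi_nhds.2 hF)
  have hgm : Measurable g := measurable_of_tendsto_metrizable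
    (fun n => ((hf n).continuous_deriv le_rfl).measurable) (tendsto_pi_nhds.2 hg)
  have hFB : ∀ t, |F t| ≤ B + C * |t| := fun t =>
    le_of_tendsto (hF t).abs (Eventually.of_forall fun n => hB n t)
  have hgC : ∀ t, |g t| ≤ C := fun t =>
    le_of_tendsto (hg t).abs (Eventually.of_forall fun n => hC n t)
  refine ⟨?_, ?_, fun φ hφ => ?_⟩
  · rw [locallyIntegrableOn_iff hΩ.isLocallyClosed]
    intro K hK hc
    have : IsFiniteMeasure (volume.restrict K) := ⟨by simpa using hc.measure_lt_top⟩
    have iu := h.1.integrableOn_compact_subset hK hc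
    exact ((integrable_const B).add (iu.abs.const_mul C)).mono'
      (hFm.comp_aemeasurable iu.1.aemeasurable).aestronglyMeasurable
      (Eventually.of_forall fun x => hFB _)
  · rw [locallyIntegrableOn_iff hΩ.isLocallyClosed]
    intro K hK hc
    have iu := h.1.integrableOn_compact_subset hK hc
    exact (h.2.1.integrableOn_compact_subset hK hc).bdd_smul C
      (hgm.comp_aemeasurable iu.1.aemeasurable).aestronglyMeasurable
      (Eventually.of_forall fun x => hgC _)
  · have iφ : IntegrableOn (fun x => (1 : ℝ) • gradient φ x) Ω :=
      integrableOn_smul_of_tsupport_subset' (u := fun _ => (1 : ℝ)) hΩ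
        (continuous_const.locallyIntegrable.locallyIntegrableOn _) hφ.gradient_continuous
        hφ.gradient_hasCompactSupport ((tsupport_gradient_subset φ).trans hφ.2.2)
    simp only [one_smul] at iφ
    have iu := h.integrableOn_left hΩ hφ
    have iG := h.integrableOn_right hΩ hφ
    have L : Tendsto (fun n => ∫ x in Ω, f n (u x) • gradient φ x) atTop
        (𝓝 (∫ x in Ω, F (u x) • gradient φ x)) := by
      refine tendsto_integral_of_dominated_convergence
        (fun x => B * ‖gradient φ x‖ + C * ‖u x • gradient φ x‖)
        (fun n => ((hn n).integrableOn_left hΩ hφ).1)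
        ((iφ.norm.const_mul B).add (iu.norm.const_mul C)) (fun n => ?_) ?_
      · refine Eventually.of_forall fun x => ?_
        rw [norm_smul, norm_smul]
        calc _ ≤ (B + C * |u x|) * ‖gradient φ x‖ :=
              mul_le_mul_of_nonneg_right (hB n _) (norm_nonneg _)
          _ = _ := by rw [Real.norm_eq_abs]; ring
      · exact Eventually.of_forall fun x => (hF _).smul_const _
    have R : Tendsto (fun n => ∫ x in Ω, φ x • (deriv (f n) (u x) • G x)) atTop
        (𝓝 (∫ x in Ω, φ x • (g (u x) • G x))) := by
      refine tendsto_integral_of_dominated_convergence (fun x => C * ‖φ x • G x‖)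
        (fun n => ((hn n).integrableOn_right hΩ hφ).1) (iG.norm.const_mul C) (fun n => ?_) ?_
      · refine Eventually.of_forall fun x => ?_
        rw [smul_comm, norm_smul]
        exact mul_le_mul_of_nonneg_right (hC n _) (norm_nonneg _)
      · exact Eventually.of_forall fun x => ((hg _).smul_const _).const_smul _
    exact tendsto_nhds_unique L (R.neg.congr fun n => ((hn n).2.2 φ hφ).symm)

lemma tendsto_one_div_add_one : Tendsto (fun n : ℕ => 1 / ((n : ℝ) + 1)) atTop (𝓝 0) :=
  tendsto_one_div_add_atTop_nhds_zero_nat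

/-- The weak gradient vanishes almost everywhere on the zero set. -/
lemma HasWeakGradient.ae_eq_zero (hΩ : IsOpen Ω) (h : HasWeakGradient Ω u G) :
    ∀ᵐ x ∂volume.restrict Ω, u x = 0 → G x = 0 := by
  let d : ℕ → ℝ := fun n => 1 / ((n : ℝ) + 1)
  have hd : ∀ n, 0 < d n := fun n => by positivity
  have hd1 : ∀ n, d n ≤ 1 := fun n => by
    have : (0 : ℝ) ≤ n := n.cast_nonneg
    exact (div_le_one (by positivity)).2 (by linarith)
  have hdt : Tendsto d atTop (𝓝 0) := tendsto_one_div_add_one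
  have hder : ∀ n t, HasDerivAt (fun t => d n * Real.arctan (t / d n))
      (1 / (1 + (t / d n) ^ 2)) t := fun n t => by
    have hne := (hd n).ne'
    refine ((((hasDerivAt_id' t).div_const (d n)).arctan).const_mul (d n)).congr_deriv ?_
    field_simp
  have harc : ∀ t, |Real.arctan t| ≤ 2 := fun t => by
    have h1 := Real.arctan_lt_pi_div_two t
    have h2 := Real.neg_pi_div_two_lt_arctan t
    have h3 := Real.pi_lt_four
    rw [abs_le]; constructor <;> linarith
  -- The functions `d arctan (t / d)` tend to `0` while their derivatives `1 / (1 + (t / d)²)` tend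
  -- to the indicator of `{0}`. Thus the zero function has weak gradient `1_{u = 0} G`, and
  -- uniqueness makes this vanish.
  have key := h.comp_of_tendsto hΩ (f := fun n t => d n * Real.arctan (t / d n))
    (F := fun _ => 0) (g := fun t => if t = 0 then 1 else 0) (B := 2) (C := 1)
    (fun n => contDiff_const.mul (Real.contDiff_arctan.comp (contDiff_id.div_const _)))
    (fun n t => ?_) (fun n t => ?_) (fun t => ?_) (fun t => ?_)
  · have h0 : HasWeakGradient Ω (fun _ : 𝔼 N => (0 : ℝ)) (fun _ => 0) := by
      have := hasWeakGradient_of_contDiff (Ω := Ω) (contDiff_const (c := (0 : ℝ)) (n := 1) (𝕜 := ℝ)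
        (E := 𝔼 N))
      simpa using this
    filter_upwards [key.ae_unique hΩ h0] with x hx hux
    simpa [hux] using hx
  · rw [abs_mul, abs_of_pos (hd n)]
    calc _ ≤ 1 * 2 := mul_le_mul (hd1 n) (harc _) (abs_nonneg _) zero_le_one
      _ ≤ _ := by linarith [abs_nonneg t]
  · rw [(hder n t).deriv, abs_of_nonneg (by positivity)]
    exact (div_le_one (by positivity)).2 (by nlinarith [sq_nonneg (t / d n)])
  · refine squeeze_zero_norm (a := fun n => d n * 2) (fun n => ?_) (by simpa using hdt.mul_const 2)
    rw [norm_mul, Real.norm_eq_abs, abs_of_pos (hd n)]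
    exact mul_le_mul_of_nonneg_left (harc _) (hd n).le
  · simp only [(hder _ t).deriv]
    by_cases ht : t = 0
    · simp [ht]
    · simp only [ht, if_false]
      have : Tendsto (fun n => 1 + (t / d n) ^ 2) atTop atTop := by
        refine tendsto_atTop_add_const_left _ _ ?_
        have h1 : ∀ n, (t / d n) ^ 2 = t ^ 2 * ((n : ℝ) + 1) ^ 2 := fun n => by
          simp only [d]; field_simp
        simp only [h1]
        refine Tendsto.const_mul_atTop (by positivity) ?_
        exact (tendsto_pow_atTop two_ne_zero).comp
          (tendsto_atTop_add_const_right _ _ tendsto_natCast_atTop_atTop)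
      exact tendsto_const_nhds.div_atTop this

/-- Approximation of `|t|` by `√(t² + d²)`. At `t = 0` the approximating derivatives vanish, which
agrees with the convention `0 / 0 = 0` in the formula. -/
lemma HasWeakGradient.abs (hΩ : IsOpen Ω) (h : HasWeakGradient Ω u G) :
    HasWeakGradient Ω (fun x => |u x|) (fun x => (u x / |u x|) • G x) := by
  let d : ℕ → ℝ := fun n => 1 / ((n : ℝ) + 1)
  have hd : ∀ n, 0 < d n := fun n => by positivity
  have hd1 : ∀ n, d n ≤ 1 := fun n => by
    have : (0 : ℝ) ≤ n := n.cast_nonneg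
    exact (div_le_one (by positivity)).2 (by linarith)
  have hdt : Tendsto d atTop (𝓝 0) := tendsto_one_div_add_one
  have hpos : ∀ n t, 0 < t ^ 2 + d n ^ 2 := fun n t => by have := hd n; positivity
  have hder : ∀ n t, HasDerivAt (fun t => √(t ^ 2 + d n ^ 2)) (t / √(t ^ 2 + d n ^ 2)) t :=
    fun n t => by
      have hsq : HasDerivAt (fun t : ℝ => t ^ 2) (2 * t) t := by simpa using hasDerivAt_pow 2 t
      refine ((hsq.add_const (d n ^ 2)).sqrt (hpos n t).ne').congr_deriv ?_
      rw [mul_div_mul_left _ _ two_ne_zero]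
  have hts : ∀ t, Tendsto (fun n => √(t ^ 2 + d n ^ 2)) atTop (𝓝 |t|) := fun t => by
    have h1 : Tendsto (fun n => √(t ^ 2 + d n ^ 2)) atTop (𝓝 √(t ^ 2 + 0 ^ 2)) :=
      ((hdt.pow 2).const_add _).sqrt
    simpa [Real.sqrt_sq_eq_abs] using h1
  refine h.comp_of_tendsto hΩ (f := fun n t => √(t ^ 2 + d n ^ 2))
    (F := fun t => |t|) (g := fun t => t / |t|) (B := 1) (C := 1)
    (fun n => ContDiff.sqrt (by fun_prop) fun t => (hpos n t).ne')
    (fun n t => ?_) (fun n t => ?_) hts (fun t => ?_)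
  · rw [abs_of_nonneg (Real.sqrt_nonneg _)]
    apply Real.sqrt_le_iff.2
    have := hd1 n
    have := hd n
    have := abs_nonneg t
    have := sq_abs t
    refine ⟨by positivity, by nlinarith⟩
  · rw [(hder n t).deriv, abs_div, abs_of_pos (Real.sqrt_pos.2 (hpos n t))]
    refine (div_le_one (Real.sqrt_pos.2 (hpos n t))).2 ?_
    apply Real.abs_le_sqrt
    have := sq_nonneg (d n)
    linarith
  · simp only [(hder _ t).deriv]
    by_cases ht : t = 0
    · simp [ht]
    · exact tendsto_const_nhds.div (hts t) (abs_ne_zero.2 ht)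

/-- From `min a b = (a + b - |a - b|) / 2`. On `{u₁ = u₂}` the two gradients agree almost everywhere
by `HasWeakGradient.ae_eq_zero`, so the branch chosen there is immaterial. -/
lemma HasWeakGradient.min (hΩ : IsOpen Ω) (h₁ : HasWeakGradient Ω u₁ G₁)
    (h₂ : HasWeakGradient Ω u₂ G₂) :
    HasWeakGradient Ω (fun x => min (u₁ x) (u₂ x))
      (fun x => if u₁ x ≤ u₂ x then G₁ x else G₂ x) := by
  have hs := h₁.sub hΩ h₂
  have key := (((h₁.add hΩ h₂).sub hΩ (hs.abs hΩ)).const_mul (1 / 2))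
  refine key.congr_ae hΩ (Eventually.of_forall fun x => ?_) ?_
  · rcases le_total (u₁ x) (u₂ x) with hx | hx
    · simp only [min_eq_left hx, abs_of_nonpos (sub_nonpos.2 hx)]; ring
    · simp only [min_eq_right hx, abs_of_nonneg (sub_nonneg.2 hx)]; ring
  · filter_upwards [hs.ae_eq_zero hΩ] with x hx
    rcases lt_trichotomy (u₁ x) (u₂ x) with hlt | heq | hgt
    · have h0 : u₁ x - u₂ x < 0 := sub_neg.2 hlt
      simp only [hlt.le, if_true, abs_of_neg h0, div_neg, div_self h0.ne]
      module
    · have h0 : G₁ x = G₂ x := sub_eq_zero.1 (hx (sub_eq_zero.2 heq))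
      simp only [heq, le_refl, if_true, h0]
      simp only [sub_self, zero_div, zero_smul]
      module
    · have h0 : 0 < u₁ x - u₂ x := sub_pos.2 hgt
      simp only [not_le.2 hgt, if_false, abs_of_pos h0, div_self h0.ne']
      module

end Lattice

/-! ### Zero boundary values by squeezing. -/

section ZeroBoundary

variable {u φ : (𝔼 N) → ℝ} {G H : (𝔼 N) → 𝔼 N}

lemma memLpVar_one_iff {F : Type*} [NormedAddCommGroup F] {w : (𝔼 N) → F} :
    MemLpVar Ω (fun _ => 1) w ↔ IntegrableOn w Ω := by
  simp only [MemLpVar, Real.rpow_one]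
  constructor
  · rintro ⟨h1, h2⟩
    exact (integrable_norm_iff h1).1 h2
  · intro h
    exact ⟨h.1, h.norm⟩

/-- A weakly differentiable function squeezed between `0` and a multiple of a function in
`W_0^{1,1}` lies in `W_0^{1,1}`. -/
lemma MemW011.of_le (hΩ : IsOpen Ω) (hu : MemW011 Ω u G) (hφ : MemW1 Ω (fun _ => 1) φ H)
    {C : ℝ} (hC : 0 ≤ C) (h0 : ∀ᵐ x ∂volume.restrict Ω, 0 ≤ φ x)
    (hle : ∀ᵐ x ∂volume.restrict Ω, φ x ≤ C * u x) : MemW011 Ω φ H := by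
  refine ⟨hφ, ?_⟩
  obtain ⟨⟨hui, hGi, hug⟩, ψ', hψ't, hψ'u, hψ'G⟩ := hu
  obtain ⟨hφi, hHi, hφg⟩ := hφ
  rw [memLpVar_one_iff] at hui hGi hφi hHi
  simp only [eLpNorm_one_eq_lintegral_enorm] at hψ'u hψ'G ⊢
  obtain ⟨ns, hns, hnsa⟩ := exists_subseq_tendsto_ae (g := ψ') (g₀ := u)
      (μ := volume.restrict Ω) (fun n => (hψ't n).1.continuous.aestronglyMeasurable) hui.1 (by
        simpa only [enorm_sub_rev] using hψ'u)
  set ψ : ℕ → (𝔼 N) → ℝ := fun n => ψ' (ns n)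
  have hψt : ∀ n, IsTestFunction Ω (ψ n) := fun n => hψ't _
  have hψu : Tendsto (fun n => ∫⁻ x in Ω, ‖u x - ψ n x‖ₑ) atTop (𝓝 0) :=
    hψ'u.comp hns.tendsto_atTop
  have hψG : Tendsto (fun n => ∫⁻ x in Ω, ‖G x - gradient (ψ n) x‖ₑ) atTop (𝓝 0) :=
    hψ'G.comp hns.tendsto_atTop
  -- Because `φ ≥ 0`, truncating it by `C ψₙ` gives zero off the support of `ψₙ`, so `m n` has
  -- compact support in `Ω`; because `φ ≤ C u`, nothing is lost in the limit.
  set m : ℕ → (𝔼 N) → ℝ := fun n x => min (φ x) (C * ψ n x)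
  set M : ℕ → (𝔼 N) → 𝔼 N := fun n x => if φ x ≤ C * ψ n x then H x else C • gradient (ψ n) x
  have hm : ∀ n, HasWeakGradient Ω (m n) (M n) := fun n =>
    hφg.min hΩ ((hasWeakGradient_of_contDiff ((hψt n).1.of_le (by simp))).const_mul C)
  -- At `n = 0` the bound is `0⁻¹ = ∞`, hence harmless.
  have happ : ∀ n, ∃ θ, IsTestFunction Ω θ ∧
      ∫⁻ x in Ω, ‖θ x - m n x‖ₑ ≤ (n : ℝ≥0∞)⁻¹ ∧
      ∫⁻ x in Ω, ‖gradient θ x - M n x‖ₑ ≤ (n : ℝ≥0∞)⁻¹ := by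
    intro n
    obtain ⟨θ, hθ, hθ1, hθ2⟩ := (hm n).exists_testFunction_tendsto hΩ (hψt n).2.1 (hψt n).2.2
      (by
        filter_upwards [h0] with x hx hxs
        simp [m, image_eq_zero_of_notMem_tsupport hxs, hx])
      (by
        filter_upwards [h0, hφg.ae_eq_zero hΩ] with x hx hx' hxs
        simp only [M, image_eq_zero_of_notMem_tsupport hxs, mul_zero,
          gradient_eq_zero_of_notMem_tsupport hxs, smul_zero]
        split_ifs with hc
        · exact hx' (le_antisymm hc hx)
        · rfl)
    have hpos : (0 : ℝ≥0∞) < (n : ℝ≥0∞)⁻¹ := ENNReal.inv_pos.2 (ENNReal.natCast_ne_top n)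
    obtain ⟨j, h1, h2⟩ := ((ENNReal.tendsto_nhds_zero.1 hθ1 _ hpos).and
      (ENNReal.tendsto_nhds_zero.1 hθ2 _ hpos)).exists
    exact ⟨θ j, hθ j, h1, h2⟩
  choose θ hθ hθ1 hθ2 using happ
  have hbm : Tendsto (fun n => ∫⁻ x in Ω, ‖m n x - φ x‖ₑ) atTop (𝓝 0) := by
    have h1 : Tendsto (fun n => ENNReal.ofReal C * ∫⁻ x in Ω, ‖u x - ψ n x‖ₑ) atTop (𝓝 0) := by
      simpa using ENNReal.Tendsto.const_mul hψu (Or.inr ENNReal.ofReal_ne_top)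
    refine tendsto_of_tendsto_of_tendsto_of_le_of_le tendsto_const_nhds h1
      (fun _ => zero_le) fun n => ?_
    dsimp only
    rw [← lintegral_const_mul' _ _ ENNReal.ofReal_ne_top]
    apply lintegral_mono_ae
    filter_upwards [hle] with x hx
    rw [← ofReal_norm, ← ofReal_norm, ← ENNReal.ofReal_mul hC]
    apply ENNReal.ofReal_le_ofReal
    simp only [m, Real.norm_eq_abs]
    rcases le_total (φ x) (C * ψ n x) with hc | hc
    · rw [min_eq_left hc]; simp only [sub_self, abs_zero]; positivity
    · rw [min_eq_right hc, abs_of_nonpos (sub_nonpos.2 hc)]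
      have := mul_le_mul_of_nonneg_left (le_abs_self (u x - ψ n x)) hC
      linarith
  have hbM : Tendsto (fun n => ∫⁻ x in Ω, ‖M n x - H x‖ₑ) atTop (𝓝 0) := by
    have h1 : Tendsto (fun n => ENNReal.ofReal C * ∫⁻ x in Ω, ‖G x - gradient (ψ n) x‖ₑ)
        atTop (𝓝 0) := by
      simpa using ENNReal.Tendsto.const_mul hψG (Or.inr ENNReal.ofReal_ne_top)
    -- `D n` is the part of the gradient error not controlled by `G - ∇ψₙ`. Where `φ < C u` it is
    -- eventually zero; where `φ = C u` the gradients `H` and `C G` coincide almost everywhere.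
    let D : ℕ → (𝔼 N) → ℝ≥0∞ := fun n x => if φ x ≤ C * ψ n x then 0 else ‖C • G x - H x‖ₑ
    have hDm : ∀ n, AEMeasurable (D n) (volume.restrict Ω) := by
      intro n
      have hs : NullMeasurableSet {x | φ x ≤ C * ψ n x} (volume.restrict Ω) :=
        nullMeasurableSet_le hφi.1.aemeasurable
          ((hψt n).1.continuous.measurable.const_mul C).aemeasurable
      have hg : AEMeasurable (fun x => ‖C • G x - H x‖ₑ) (volume.restrict Ω) :=
        ((hGi.1.const_smul C).sub hHi.1).enorm
      have := hg.indicator₀ hs.compl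
      refine this.congr (Eventually.of_forall fun x => ?_)
      by_cases hx : φ x ≤ C * ψ n x
      · simp [D, hx]
      · have hx' := not_le.1 hx
        simp [D, hx']
    have h2 : Tendsto (fun n => ∫⁻ x in Ω, D n x) atTop (𝓝 0) := by
      have := tendsto_lintegral_of_dominated_convergence' (μ := volume.restrict Ω)
        (F := D) (f := fun _ => 0) (fun x => ‖C • G x - H x‖ₑ) hDm ?_ ?_ ?_
      · simpa using this
      · intro n
        refine Eventually.of_forall fun x => ?_
        simp only [D]
        split_ifs <;> simp
      · exact ((hGi.smul C).sub hHi).2.ne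
      · have hdiff := ((hug.const_mul C).sub hΩ hφg).ae_eq_zero hΩ
        filter_upwards [hdiff, hle, hnsa] with x hx hxle hxt
        rcases hxle.lt_or_eq with hlt | heq
        · have hev : ∀ᶠ n in atTop, φ x < C * ψ n x :=
            (hxt.const_mul C).eventually_const_lt hlt
          refine tendsto_const_nhds.congr' ?_
          filter_upwards [hev] with n hn
          simp [D, hn.le]
        · have : C • G x - H x = 0 := hx (sub_eq_zero.2 heq.symm)
          simp [D, this]
    have h12 := h1.add h2
    rw [add_zero] at h12
    refine tendsto_of_tendsto_of_tendsto_of_le_of_le tendsto_const_nhds h12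
      (fun _ => zero_le) fun n => ?_
    dsimp only
    rw [← lintegral_const_mul' _ _ ENNReal.ofReal_ne_top, ← lintegral_add_right' _ (hDm n)]
    apply lintegral_mono
    intro x
    simp only [M, D]
    split_ifs with hc
    · simp
    · have : C • gradient (ψ n) x - H x
          = -(C • (G x - gradient (ψ n) x)) + (C • G x - H x) := by module
      rw [this]
      refine (enorm_add_le _ _).trans ?_
      rw [enorm_neg, enorm_smul, Real.enorm_of_nonneg hC]
  have hinv : Tendsto (fun n : ℕ => (n : ℝ≥0∞)⁻¹) atTop (𝓝 0) :=
    ENNReal.tendsto_inv_nat_nhds_zero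
  refine ⟨θ, hθ, ?_, ?_⟩
  · have hl := hinv.add hbm
    rw [add_zero] at hl
    refine tendsto_of_tendsto_of_tendsto_of_le_of_le tendsto_const_nhds hl
      (fun _ => zero_le) fun n => ?_
    have hmeas : AEMeasurable (fun x => ‖m n x - φ x‖ₑ) (volume.restrict Ω) :=
      ((hm n).1.aestronglyMeasurable.sub hφi.1).enorm
    calc ∫⁻ x in Ω, ‖φ x - θ n x‖ₑ
        ≤ ∫⁻ x in Ω, (‖θ n x - m n x‖ₑ + ‖m n x - φ x‖ₑ) := by
          apply lintegral_mono
          intro x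
          dsimp only
          rw [enorm_sub_rev, ← sub_add_sub_cancel (θ n x) (m n x) (φ x)]
          exact enorm_add_le _ _
      _ = _ := lintegral_add_right' _ hmeas
      _ ≤ _ := by gcongr; exact hθ1 n
  · have hl := hinv.add hbM
    rw [add_zero] at hl
    refine tendsto_of_tendsto_of_tendsto_of_le_of_le tendsto_const_nhds hl
      (fun _ => zero_le) fun n => ?_
    have hmeas : AEMeasurable (fun x => ‖M n x - H x‖ₑ) (volume.restrict Ω) :=
      ((hm n).2.1.aestronglyMeasurable.sub hHi.1).enorm
    calc ∫⁻ x in Ω, ‖H x - gradient (θ n) x‖ₑ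
        ≤ ∫⁻ x in Ω, (‖gradient (θ n) x - M n x‖ₑ + ‖M n x - H x‖ₑ) := by
          apply lintegral_mono
          intro x
          dsimp only
          rw [enorm_sub_rev, ← sub_add_sub_cancel (gradient (θ n) x) (M n x) (H x)]
          exact enorm_add_le _ _
      _ = _ := lintegral_add_right' _ hmeas
      _ ≤ _ := by gcongr; exact hθ2 n

end ZeroBoundary

/-! ### Chain rule for powers of functions bounded away from zero. -/

section Powers

variable {u₁ u₂ : (𝔼 N) → ℝ} {G₁ G₂ : (𝔼 N) → 𝔼 N}

/-- Chain rule for a function that is `C¹` near a compact set containing all the values. -/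
lemma HasWeakGradient.comp_prodMk_of_mem (hΩ : IsOpen Ω) (h₁ : HasWeakGradient Ω u₁ G₁)
    (h₂ : HasWeakGradient Ω u₂ G₂) {F : ℝ × ℝ → ℝ} {U K : Set (ℝ × ℝ)} (hU : IsOpen U)
    (hF : ContDiffOn ℝ 1 F U) (hK : IsCompact K) (hKU : K ⊆ U)
    (hm : ∀ᵐ x ∂volume.restrict Ω, (u₁ x, u₂ x) ∈ K) :
    HasWeakGradient Ω (fun x => F (u₁ x, u₂ x))
      (fun x => fderiv ℝ F (u₁ x, u₂ x) (1, 0) • G₁ x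
        + fderiv ℝ F (u₁ x, u₂ x) (0, 1) • G₂ x) := by
  obtain ⟨χ, hχ, hχc, hχU, hχ1⟩ := exists_contDiff_cutoff hU hK hKU
  -- Multiplying by the cutoff yields a globally `C¹`, compactly supported function, hence one with
  -- bounded derivative, that agrees with `F` near every attained value.
  have hχF : ContDiff ℝ 1 (fun z => χ z * F z) := by
    rw [contDiff_iff_contDiffAt]
    intro z
    by_cases hz : z ∈ U
    · exact ((hχ.of_le (by simp)).contDiffAt).mul (hF.contDiffAt (hU.mem_nhds hz))
    · have hz' : z ∉ tsupport χ := fun h => hz (hχU h)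
      have : (fun z => χ z * F z) =ᶠ[𝓝 z] fun _ => 0 := by
        filter_upwards [notMem_tsupport_iff_eventuallyEq.1 hz'] with y hy
        simp [hy]
      exact contDiffAt_const.congr_of_eventuallyEq this
  have hcs : HasCompactSupport (fun z => χ z * F z) := hχc.mul_right
  obtain ⟨C, hC⟩ := (hcs.fderiv ℝ).exists_bound_of_continuous
    (hχF.continuous_fderiv one_ne_zero)
  have heq : ∀ z ∈ K, (fun z => χ z * F z) =ᶠ[𝓝 z] F := fun z hz => by
    filter_upwards [hχ1 z hz] with y hy
    simp [hy]
  refine (h₁.comp_prodMk hΩ h₂ hχF hC).congr_ae hΩ ?_ ?_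
  · filter_upwards [hm] with x hx
    exact (heq _ hx).self_of_nhds
  · filter_upwards [hm] with x hx
    rw [(heq _ hx).fderiv_eq]

/-- The weak gradient of `u₁ - u₂ ^ q * u₁ ^ (1 - q)` for bounded `u₁`, `u₂` that are bounded
away from zero. -/
lemma HasWeakGradient.sub_rpow_mul_rpow (hΩ : IsOpen Ω) (h₁ : HasWeakGradient Ω u₁ G₁)
    (h₂ : HasWeakGradient Ω u₂ G₂) (q : ℝ) {ε M : ℝ} (hε : 0 < ε)
    (hm₁ : ∀ᵐ x ∂volume.restrict Ω, u₁ x ∈ Set.Icc ε M)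
    (hm₂ : ∀ᵐ x ∂volume.restrict Ω, u₂ x ∈ Set.Icc ε M) :
    HasWeakGradient Ω (fun x => u₁ x - u₂ x ^ q * u₁ x ^ (1 - q))
      (fun x => (1 + (q - 1) * (u₂ x ^ q * u₁ x ^ (-q))) • G₁ x
        - (q * (u₂ x ^ (q - 1) * u₁ x ^ (1 - q))) • G₂ x) := by
  set F : ℝ × ℝ → ℝ := fun z => z.1 - z.2 ^ q * z.1 ^ (1 - q)
  set U : Set (ℝ × ℝ) := Set.Ioi 0 ×ˢ Set.Ioi 0
  have hU : IsOpen U := isOpen_Ioi.prod isOpen_Ioi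
  have hF : ContDiffOn ℝ 1 F U := by
    refine contDiffOn_fst.sub ((contDiffOn_snd.rpow_const_of_ne ?_).mul
      (contDiffOn_fst.rpow_const_of_ne ?_))
    · exact fun z hz => (show (0 : ℝ) < z.2 from hz.2).ne'
    · exact fun z hz => (show (0 : ℝ) < z.1 from hz.1).ne'
  have hmK : ∀ᵐ x ∂volume.restrict Ω, (u₁ x, u₂ x) ∈ Set.Icc ε M ×ˢ Set.Icc ε M := by
    filter_upwards [hm₁, hm₂] with x hx hx'
    exact ⟨hx, hx'⟩
  have hKU : Set.Icc ε M ×ˢ Set.Icc ε M ⊆ U := Set.prod_mono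
    (fun t ht => hε.trans_le ht.1) (fun t ht => hε.trans_le ht.1)
  refine (h₁.comp_prodMk_of_mem hΩ h₂ hU hF (isCompact_Icc.prod isCompact_Icc) hKU hmK).congr_ae hΩ
    (Eventually.of_forall fun x => rfl) ?_
  filter_upwards [hmK] with x hx
  have h1 : 0 < u₁ x := (hKU hx).1
  have h2 : 0 < u₂ x := (hKU hx).2
  have hd := (hasFDerivAt_fst (𝕜 := ℝ) (p := (u₁ x, u₂ x))).sub
    (((hasFDerivAt_snd (𝕜 := ℝ) (p := (u₁ x, u₂ x))).rpow_const (p := q) (Or.inl h2.ne')).mul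
    ((hasFDerivAt_fst (𝕜 := ℝ) (p := (u₁ x, u₂ x))).rpow_const (p := 1 - q) (Or.inl h1.ne')))
  have hd' : HasFDerivAt F _ (u₁ x, u₂ x) := hd
  rw [hd'.fderiv]
  calc _ = (1 + (q - 1) * (u₂ x ^ q * u₁ x ^ (-q))) • G₁ x
        + (-(q * (u₂ x ^ (q - 1) * u₁ x ^ (1 - q)))) • G₂ x := by
        congr 2
        · simp [show 1 - q - 1 = -q by ring]
          ring
        · simp
          ring
    _ = _ := by module

end Powers

/-! ### The Picone inequality and the truncated energy estimate. -/

section RealInequalities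

lemma young_rpow {q : ℝ} (hq : 1 < q) {a b : ℝ} (ha : 0 ≤ a) (hb : 0 ≤ b) :
    q * (a ^ (q - 1) * b) ≤ (q - 1) * a ^ q + b ^ q := by
  have hq0 : 0 < q := by linarith
  have h := Real.geom_mean_le_arith_mean2_weighted (w₁ := (q - 1) / q) (w₂ := 1 / q)
    (p₁ := a ^ q) (p₂ := b ^ q) (div_nonneg (by linarith) hq0.le) (by positivity)
    (by positivity) (by positivity) (by field_simp; ring)
  rw [← Real.rpow_mul ha, ← Real.rpow_mul hb, mul_div_cancel₀ _ hq0.ne',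
    mul_one_div_cancel hq0.ne', Real.rpow_one] at h
  calc q * (a ^ (q - 1) * b) ≤ q * ((q - 1) / q * a ^ q + 1 / q * b ^ q) :=
        mul_le_mul_of_nonneg_left h hq0.le
    _ = _ := by field_simp

/-- A discrete Picone-type inequality behind the convexity of `w ↦ |∇ w^{1/q}|^p` for `q ≤ p`. -/
lemma picone_inequality {q p : ℝ} (hq : 1 < q) (hqp : q ≤ p) {t X Y : ℝ} (ht : 0 < t)
    (hX : 0 ≤ X) (hY : 0 ≤ Y) :
    q * t ^ (q - 1) * (X ^ (p - 1) * Y) + q * (t⁻¹) ^ (q - 1) * (Y ^ (p - 1) * X)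
      ≤ (1 + (q - 1) * t ^ q) * X ^ p + (1 + (q - 1) * (t⁻¹) ^ q) * Y ^ p := by
  -- Young's inequality for `t X` and `Y`, multiplied by `X ^ (p - q)`.
  have key : ∀ {t X Y : ℝ}, 0 < t → 0 ≤ X → 0 ≤ Y → q * t ^ (q - 1) * (X ^ (p - 1) * Y)
      ≤ (q - 1) * t ^ q * X ^ p + X ^ (p - q) * Y ^ q := by
    intro t X Y ht hX hY
    have h := young_rpow hq (mul_nonneg ht.le hX) hY
    have hm := mul_le_mul_of_nonneg_left h (Real.rpow_nonneg hX (p - q))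
    rw [Real.mul_rpow ht.le hX, Real.mul_rpow ht.le hX] at hm
    have e1 : X ^ (p - 1) = X ^ (p - q) * X ^ (q - 1) := by
      rw [← Real.rpow_add_of_nonneg hX (by linarith) (by linarith)]; congr 1; ring
    have e2 : X ^ p = X ^ (p - q) * X ^ q := by
      rw [← Real.rpow_add_of_nonneg hX (by linarith) (by linarith)]; congr 1; ring
    rw [e1, e2]
    linarith
  have h1 := key ht hX hY
  have h2 := key (inv_pos.2 ht) hY hX
  have eX : X ^ p = X ^ (p - q) * X ^ q := by
    rw [← Real.rpow_add_of_nonneg hX (by linarith) (by linarith)]; congr 1; ring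
  have eY : Y ^ p = Y ^ (p - q) * Y ^ q := by
    rw [← Real.rpow_add_of_nonneg hY (by linarith) (by linarith)]; congr 1; ring
  -- Adding the two instances of `key` leaves `X^(p-q) Y^q + Y^(p-q) X^q`. It is at most `X^p + Y^p`
  -- because both powers are monotone, and this is where `q ≤ p` enters.
  have hmono : 0 ≤ (X ^ (p - q) - Y ^ (p - q)) * (X ^ q - Y ^ q) := by
    rcases le_total X Y with h | h
    · exact mul_nonneg_of_nonpos_of_nonpos
        (sub_nonpos.2 (Real.rpow_le_rpow hX h (by linarith)))
        (sub_nonpos.2 (Real.rpow_le_rpow hX h (by linarith)))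
    · exact mul_nonneg (sub_nonneg.2 (Real.rpow_le_rpow hY h (by linarith)))
        (sub_nonneg.2 (Real.rpow_le_rpow hY h (by linarith)))
  nlinarith [h1, h2, eX, eY, hmono]

lemma rpow_sub_one_mul_le {p X Y : ℝ} (hp : 1 < p) (hX : 0 ≤ X) (hY : 0 ≤ Y) :
    X ^ (p - 1) * Y ≤ X ^ p + Y ^ p := by
  have e : ∀ {Z : ℝ}, 0 ≤ Z → Z ^ (p - 1) * Z = Z ^ p := fun {Z} hZ => by
    nth_rewrite 2 [← Real.rpow_one Z]
    rw [← Real.rpow_add_of_nonneg hZ (by linarith) zero_le_one]; congr 1; ring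
  rcases le_total X Y with h | h
  · have := mul_le_mul_of_nonneg_right (Real.rpow_le_rpow hX h (by linarith : 0 ≤ p - 1)) hY
    rw [e hY] at this
    have := Real.rpow_nonneg hX p
    linarith
  · have := mul_le_mul_of_nonneg_left h (Real.rpow_nonneg hX (p - 1))
    rw [e hX] at this
    have := Real.rpow_nonneg hY p
    linarith

variable {V : Type*} [NormedAddCommGroup V] [InnerProductSpace ℝ V]

lemma inner_rpow_smul_self {p : ℝ} (hp : 1 < p) (A : V) :
    inner ℝ (‖A‖ ^ (p - 2) • A) A = ‖A‖ ^ p := by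
  rcases eq_or_ne A 0 with rfl | hA
  · simp [Real.zero_rpow (by linarith : p ≠ 0)]
  · have : 0 < ‖A‖ := norm_pos_iff.2 hA
    rw [real_inner_smul_left, real_inner_self_eq_norm_sq, ← Real.rpow_natCast, ← Real.rpow_add this]
    norm_num

lemma norm_rpow_smul_self {p : ℝ} (hp : 1 < p) (A : V) :
    ‖‖A‖ ^ (p - 2) • A‖ = ‖A‖ ^ (p - 1) := by
  rcases eq_or_ne A 0 with rfl | hA
  · simp [Real.zero_rpow (by linarith : p - 1 ≠ 0)]
  · have h0 : 0 < ‖A‖ := norm_pos_iff.2 hA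
    rw [norm_smul, Real.norm_of_nonneg (by positivity)]
    nth_rewrite 2 [← Real.rpow_one ‖A‖]
    rw [← Real.rpow_add h0]
    congr 1; ring

lemma abs_inner_rpow_smul_le {p : ℝ} (hp : 1 < p) (A B : V) :
    |inner ℝ (‖A‖ ^ (p - 2) • A) B| ≤ ‖A‖ ^ (p - 1) * ‖B‖ := by
  rw [← norm_rpow_smul_self hp]
  exact abs_real_inner_le_norm _ _

/-- The function `a ^ (1 - q) * (a ^ q - b ^ q)`. -/
noncomputable def piconeTest (q a b : ℝ) : ℝ := a - b ^ q * a ^ (1 - q)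

/-- The gradient of `piconeTest q a b` if `A = ∇a` and `B = ∇b`. -/
noncomputable def piconeGrad (q a b : ℝ) (A B : V) : V :=
  (1 + (q - 1) * (b ^ q * a ^ (-q))) • A - (q * (b ^ (q - 1) * a ^ (1 - q))) • B

lemma rpow_mul_rpow_neg_eq {a b r : ℝ} (ha : 0 < a) (hb : 0 < b) :
    b ^ r * a ^ (-r) = (b / a) ^ r := by
  rw [Real.div_rpow hb.le ha.le, Real.rpow_neg ha.le, div_eq_mul_inv]

lemma piconeTest_eq {q a b : ℝ} (ha : 0 < a) :
    piconeTest q a b = (a ^ q - b ^ q) * a ^ (1 - q) := by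
  have : a ^ q * a ^ (1 - q) = a := by
    rw [← Real.rpow_add ha]; simp
  rw [piconeTest, sub_mul, this]

/-- The coefficients are homogeneous of degree zero in `(a, b)`, so only the ratio `b / a` matters;
it plays the role of `t` in `picone_inequality`. -/
lemma piconeGrad_eq {q a b : ℝ} (ha : 0 < a) (hb : 0 < b) (A B : V) :
    piconeGrad q a b A B = (1 + (q - 1) * (b / a) ^ q) • A - (q * (b / a) ^ (q - 1)) • B := by
  rw [piconeGrad, rpow_mul_rpow_neg_eq ha hb, show 1 - q = -(q - 1) by ring,
    rpow_mul_rpow_neg_eq ha hb]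

lemma piconeGrad_self {q a : ℝ} (ha : 0 < a) (A : V) : piconeGrad q a a A A = 0 := by
  rw [piconeGrad_eq ha ha, div_self ha.ne', Real.one_rpow, Real.one_rpow, ← sub_smul]
  simp

lemma norm_piconeGrad_le {q ε M a b : ℝ} (hq : 1 < q) (hε : 0 < ε) (ha : a ∈ Set.Icc ε M)
    (hb : b ∈ Set.Icc ε M) (A B : V) :
    ‖piconeGrad q a b A B‖
      ≤ (1 + (q - 1) * (M / ε) ^ q + q * (M / ε) ^ (q - 1)) * (‖A‖ + ‖B‖) := by
  have ha0 : 0 < a := hε.trans_le ha.1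
  have hb0 : 0 < b := hε.trans_le hb.1
  have hM0 : 0 < M := ha0.trans_le ha.2
  have hr : b / a ≤ M / ε := div_le_div₀ hM0.le hb.2 hε ha.1
  have h1 : (b / a) ^ q ≤ (M / ε) ^ q := Real.rpow_le_rpow (by positivity) hr (by linarith)
  have h2 : (b / a) ^ (q - 1) ≤ (M / ε) ^ (q - 1) :=
    Real.rpow_le_rpow (by positivity) hr (by linarith)
  have hq1 : 0 ≤ q - 1 := by linarith
  have hq0 : 0 ≤ q := by linarith
  rw [piconeGrad_eq ha0 hb0]
  refine (norm_sub_le _ _).trans ?_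
  rw [norm_smul, norm_smul, Real.norm_of_nonneg (by positivity),
    Real.norm_of_nonneg (by positivity)]
  have e1 : (1 + (q - 1) * (b / a) ^ q) * ‖A‖ ≤ (1 + (q - 1) * (M / ε) ^ q) * ‖A‖ := by gcongr
  have e2 : (q * (b / a) ^ (q - 1)) * ‖B‖ ≤ (q * (M / ε) ^ (q - 1)) * ‖B‖ := by gcongr
  have e3 : 0 ≤ (1 + (q - 1) * (M / ε) ^ q) * ‖B‖ := by positivity
  have e4 : 0 ≤ (q * (M / ε) ^ (q - 1)) * ‖A‖ := by positivity
  nlinarith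

/-- Cauchy–Schwarz on the mixed terms reduces this to the scalar inequality with `t = b / a`, `X =
‖A‖`, `Y = ‖B‖`. -/
lemma picone_inner_nonneg {q p : ℝ} (hq : 1 < q) (hqp : q ≤ p) {a b : ℝ} (ha : 0 < a)
    (hb : 0 < b) (A B : V) :
    0 ≤ inner ℝ (‖A‖ ^ (p - 2) • A) (piconeGrad q a b A B)
      + inner ℝ (‖B‖ ^ (p - 2) • B) (piconeGrad q b a B A) := by
  have hp : 1 < p := hq.trans_le hqp
  have hba : 0 < b / a := by positivity
  have h := picone_inequality hq hqp hba (norm_nonneg A) (norm_nonneg B)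
  rw [piconeGrad_eq ha hb, piconeGrad_eq hb ha, inner_sub_right, inner_sub_right,
    real_inner_smul_right _ _ (1 + _), real_inner_smul_right _ _ (q * _),
    real_inner_smul_right _ _ (1 + _), real_inner_smul_right _ _ (q * _),
    inner_rpow_smul_self hp, inner_rpow_smul_self hp]
  rw [inv_div] at h
  have hab : 0 < a / b := by positivity
  have h1 := mul_le_mul_of_nonneg_left (le_of_abs_le (abs_inner_rpow_smul_le hp A B))
    (by positivity : 0 ≤ q * (b / a) ^ (q - 1))
  have h2 := mul_le_mul_of_nonneg_left (le_of_abs_le (abs_inner_rpow_smul_le hp B A))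
    (by positivity : 0 ≤ q * (a / b) ^ (q - 1))
  linarith

/-- The pointwise energy inequality for the truncated test functions. -/
lemma energy_lower_bound {q p : ℝ} (hq : 1 < q) (hqp : q ≤ p) {v w k ε : ℝ} (hv : 0 < v)
    (hw : 0 < w) (hk : 0 < k) (hε : 0 < ε) (A B : V) {A' B' : V}
    (hA' : A' = if v ≤ k then A else 0) (hB' : B' = if min v k ≤ w then A' else B) :
    -(if k < v then q * (‖A‖ ^ (p - 1) * ‖B‖) else 0) ≤
      inner ℝ (‖A‖ ^ (p - 2) • A)
        (piconeGrad q (min v k + ε) (min (min v k) w + ε) A' B')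
      + inner ℝ (‖B‖ ^ (p - 2) • B)
        (piconeGrad q (min (min v k) w + ε) (min v k + ε) B' A') := by
  have hp : 1 < p := hq.trans_le hqp
  have hs : 0 < min v k + ε := by positivity
  have hm : 0 < min (min v k) w + ε := by positivity
  -- If `min v k ≤ w`, the two arguments coincide and both gradients vanish. Otherwise `v ≤ k` is
  -- the genuine Picone case, while `k < v` forces `A' = 0`: the pure `B` term is nonnegative, and
  -- the mixed term is bounded by the stated error since the ratio of the truncations is at most
  -- `1`.
  by_cases h1 : min v k ≤ w
  · rw [if_pos h1] at hB'
    rw [min_eq_left h1, hB', piconeGrad_self hs]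
    simp only [inner_zero_right, add_zero]
    split_ifs
    · have : 0 ≤ q * (‖A‖ ^ (p - 1) * ‖B‖) := by positivity
      linarith
    · simp
  · rw [if_neg h1] at hB'
    subst hB'
    by_cases h2 : v ≤ k
    · rw [if_pos h2] at hA'
      subst hA'
      rw [if_neg (not_lt.2 h2), neg_zero]
      exact picone_inner_nonneg hq hqp hs hm _ _
    · rw [if_neg h2] at hA'
      subst hA'
      rw [if_pos (not_le.1 h2), piconeGrad_eq hs hm, piconeGrad_eq hm hs]
      simp only [smul_zero, zero_sub, sub_zero, inner_neg_right]
      rw [real_inner_smul_right, real_inner_smul_right, inner_rpow_smul_self hp]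
      have ht : (min (min v k) w + ε) / (min v k + ε) ≤ 1 :=
        (div_le_one hs).2 (by linarith [min_le_left (min v k) w])
      have ht' : ((min (min v k) w + ε) / (min v k + ε)) ^ (q - 1) ≤ 1 :=
        Real.rpow_le_one (by positivity) ht (by linarith)
      have e1 := le_of_abs_le (abs_inner_rpow_smul_le hp A B')
      have e2 : 0 ≤ ‖A‖ ^ (p - 1) * ‖B'‖ := by positivity
      have e3 : 0 ≤ ((min (min v k) w + ε) / (min v k + ε)) ^ (q - 1) := by positivity
      have hq1 : 0 ≤ q - 1 := by linarith
      have e4 : 0 ≤ (1 + (q - 1) * ((min v k + ε) / (min (min v k) w + ε)) ^ q) * ‖B'‖ ^ p := by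
        positivity
      have e5 : q * ((min (min v k) w + ε) / (min v k + ε)) ^ (q - 1) *
          inner ℝ (‖A‖ ^ (p - 2) • A) B' ≤ q * (‖A‖ ^ (p - 1) * ‖B'‖) := by
        rw [mul_assoc]
        apply mul_le_mul_of_nonneg_left _ (by linarith)
        calc _ ≤ ((min (min v k) w + ε) / (min v k + ε)) ^ (q - 1) * (‖A‖ ^ (p - 1) * ‖B'‖) :=
              mul_le_mul_of_nonneg_left e1 e3
          _ ≤ 1 * (‖A‖ ^ (p - 1) * ‖B'‖) := mul_le_mul_of_nonneg_right ht' e2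
          _ = _ := one_mul _
      linarith

/-! ### Pointwise bounds on the truncated test functions. -/

section TestBounds

variable {q v w k ε : ℝ}

lemma piconeTest_trunc_nonneg (hq : 1 < q) (hv : 0 < v) (hw : 0 < w) (hk : 0 < k) (hε : 0 < ε) :
    0 ≤ piconeTest q (min v k + ε) (min (min v k) w + ε) := by
  have hs : 0 < min v k + ε := by positivity
  have hm : 0 < min (min v k) w + ε := by positivity
  rw [piconeTest_eq hs]
  refine mul_nonneg (sub_nonneg.2 (Real.rpow_le_rpow hm.le ?_ (by linarith))) (by positivity)
  linarith [min_le_left (min v k) w]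

/-- The tangent-line bound `s^q - m^q ≤ q s^(q-1) (s - m)` together with `s - m ≤ v`, in which `ε`
cancels. The constant is independent of `k` and `ε`, as dominated convergence later requires. -/
lemma piconeTest_trunc_le (hq : 1 < q) (hv : 0 < v) (hw : 0 < w) (hk : 0 < k) (hε : 0 < ε) :
    piconeTest q (min v k + ε) (min (min v k) w + ε) ≤ q * v := by
  have hs : 0 < min v k + ε := by positivity
  have hm : 0 < min (min v k) w + ε := by positivity
  rw [piconeTest_eq hs]
  set s := min v k + ε
  set m := min (min v k) w + ε
  have hsm : s - m ≤ v := by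
    have h1 : min v k ≤ v := min_le_left _ _
    have h2 : 0 < min (min v k) w := by positivity
    simp only [s, m]; linarith
  have hy := young_rpow hq hs.le hm.le
  have e1 : s ^ (q - 1) * s = s ^ q := by
    rw [← Real.rpow_add_one hs.ne']; congr 1; ring
  have e2 : s ^ (q - 1) * s ^ (1 - q) = 1 := by
    rw [← Real.rpow_add hs]; simp
  have h1 : s ^ q - m ^ q ≤ q * s ^ (q - 1) * (s - m) := by
    have : q * s ^ (q - 1) * (s - m) = q * s ^ q - q * (s ^ (q - 1) * m) := by
      rw [← e1]; ring
    rw [this]; linarith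
  calc (s ^ q - m ^ q) * s ^ (1 - q) ≤ q * s ^ (q - 1) * (s - m) * s ^ (1 - q) :=
        mul_le_mul_of_nonneg_right h1 (by positivity)
    _ = q * (s - m) * (s ^ (q - 1) * s ^ (1 - q)) := by ring
    _ = q * (s - m) := by rw [e2, mul_one]
    _ ≤ q * v := mul_le_mul_of_nonneg_left hsm (by linarith)

lemma neg_piconeTest_trunc_eq (hv : 0 < v) (hw : 0 < w) (hk : 0 < k) (hε : 0 < ε) :
    -piconeTest q (min (min v k) w + ε) (min v k + ε)
      = ((min v k + ε) / (min (min v k) w + ε)) ^ (q - 1) *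
        piconeTest q (min v k + ε) (min (min v k) w + ε) := by
  have hs : 0 < min v k + ε := by positivity
  have hm : 0 < min (min v k) w + ε := by positivity
  rw [piconeTest_eq hs, piconeTest_eq hm]
  set s := min v k + ε
  set m := min (min v k) w + ε
  rw [Real.div_rpow hs.le hm.le, show 1 - q = -(q - 1) by ring, Real.rpow_neg hs.le,
    Real.rpow_neg hm.le]
  have h1 : 0 < s ^ (q - 1) := by positivity
  have h2 : 0 < m ^ (q - 1) := by positivity
  field_simp
  ring

lemma neg_piconeTest_trunc_nonneg (hq : 1 < q) (hv : 0 < v) (hw : 0 < w) (hk : 0 < k)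
    (hε : 0 < ε) : 0 ≤ -piconeTest q (min (min v k) w + ε) (min v k + ε) := by
  rw [neg_piconeTest_trunc_eq hv hw hk hε]
  have hs : 0 < min v k + ε := by positivity
  have hm : 0 < min (min v k) w + ε := by positivity
  exact mul_nonneg (by positivity) (piconeTest_trunc_nonneg hq hv hw hk hε)

/-- This constant blows up as `ε → 0`; the bound serves only the admissibility of the test function
for fixed `k` and `ε`. -/
lemma neg_piconeTest_trunc_le (hq : 1 < q) (hv : 0 < v) (hw : 0 < w) (hk : 0 < k)
    (hε : 0 < ε) : -piconeTest q (min (min v k) w + ε) (min v k + ε)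
      ≤ (((k + ε) / ε) ^ (q - 1) * q) * v := by
  rw [neg_piconeTest_trunc_eq hv hw hk hε, mul_assoc]
  have hs : 0 < min v k + ε := by positivity
  have hm : 0 < min (min v k) w + ε := by positivity
  refine mul_le_mul (Real.rpow_le_rpow (by positivity) ?_ (by linarith))
    (piconeTest_trunc_le hq hv hw hk hε) (piconeTest_trunc_nonneg hq hv hw hk hε) (by positivity)
  have h0 : 0 < min (min v k) w := by positivity
  exact div_le_div₀ (by positivity) (by linarith [min_le_right v k]) hε (by linarith)

/-- The test functions vanish where `v ≤ w`. -/
lemma piconeTest_trunc_eq_zero (hv : 0 < v) (hk : 0 < k) (hε : 0 < ε)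
    (hvw : v ≤ w) : piconeTest q (min v k + ε) (min (min v k) w + ε) = 0 := by
  have hs : 0 < min v k + ε := by positivity
  rw [min_eq_left ((min_le_left _ _).trans hvw), piconeTest_eq hs]
  simp

/-- After factoring out the common test function, the claim on `{w < min v k}` is `w (min v k + ε) /
(w + ε) ≤ v`: adding `ε` to both truncations only brings their ratio closer to `1`. -/
lemma rpow_mul_neg_piconeTest_le (hq : 1 < q) (hv : 0 < v) (hw : 0 < w) (hk : 0 < k)
    (hε : 0 < ε) : w ^ (q - 1) * -piconeTest q (min (min v k) w + ε) (min v k + ε)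
      ≤ v ^ (q - 1) * piconeTest q (min v k + ε) (min (min v k) w + ε) := by
  rw [neg_piconeTest_trunc_eq hv hw hk hε, ← mul_assoc]
  have hs : 0 < min v k + ε := by positivity
  have hm : 0 < min (min v k) w + ε := by positivity
  rcases le_or_gt (min v k) w with h | h
  · have : piconeTest q (min v k + ε) (min (min v k) w + ε) = 0 := by
      rw [min_eq_left h, piconeTest_eq hs]; simp
    simp [this]
  · apply mul_le_mul_of_nonneg_right _ (piconeTest_trunc_nonneg hq hv hw hk hε)
    rw [← Real.mul_rpow hw.le (by positivity)]
    apply Real.rpow_le_rpow (by positivity) _ (by linarith)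
    rw [min_eq_right h.le, mul_div_assoc', div_le_iff₀ (by positivity)]
    have h1 : min v k ≤ v := min_le_left _ _
    nlinarith

end TestBounds

lemma tendsto_truncation {v w : ℝ} :
    Tendsto (fun n : ℕ => min v ((n : ℝ) + 1) + 1 / ((n : ℝ) + 1)) atTop (𝓝 v) ∧
    Tendsto (fun n : ℕ => min (min v ((n : ℝ) + 1)) w + 1 / ((n : ℝ) + 1)) atTop
      (𝓝 (min v w)) := by
  have h1 : Tendsto (fun n : ℕ => min v ((n : ℝ) + 1)) atTop (𝓝 v) := by
    refine tendsto_const_nhds.congr' ?_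
    filter_upwards [(tendsto_atTop_add_const_right _ 1
      (tendsto_natCast_atTop_atTop (R := ℝ))).eventually_ge_atTop v] with n hn
    exact (min_eq_left hn).symm
  constructor
  · simpa using h1.add tendsto_one_div_add_one
  · simpa using (h1.min (tendsto_const_nhds (x := w))).add tendsto_one_div_add_one

lemma tendsto_piconeTest {q a b : ℝ} (ha : 0 < a) (hb : 0 < b) {s m : ℕ → ℝ}
    (hs : Tendsto s atTop (𝓝 a)) (hm : Tendsto m atTop (𝓝 b)) :
    Tendsto (fun n => piconeTest q (s n) (m n)) atTop (𝓝 (piconeTest q a b)) :=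
  hs.sub ((hm.rpow_const (Or.inl hb.ne')).mul (hs.rpow_const (Or.inl ha.ne')))

lemma rpow_mul_piconeTest {q a b : ℝ} (ha : 0 < a) :
    a ^ (q - 1) * piconeTest q a b = a ^ q - b ^ q := by
  rw [piconeTest_eq ha, mul_left_comm, ← Real.rpow_add ha]
  simp

end RealInequalities

/-! ### Variable exponent integrability and admissibility of test functions. -/

section Membership

variable {p : (𝔼 N) → ℝ} {P q : ℝ}

/-- The base is enlarged to `2 * max 1 D ≥ 1`, so that its power can be bounded with the uniform
exponent `P`, giving a constant independent of the point. -/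
lemma rpow_le_of_le_mul_add {p P D x a b : ℝ} (hp : 1 ≤ p) (hpP : p ≤ P) (hx : 0 ≤ x)
    (ha : 0 ≤ a) (hb : 0 ≤ b) (h : x ≤ D * (a + b)) :
    x ^ p ≤ (2 * max 1 D) ^ P * (a ^ p + b ^ p) := by
  have hp0 : 0 ≤ p := by linarith
  have hM : (1 : ℝ) ≤ 2 * max 1 D := by
    have := le_max_left 1 D
    linarith
  have h1 : x ≤ (2 * max 1 D) * max a b := by
    have e1 : D * (a + b) ≤ max 1 D * (a + b) :=
      mul_le_mul_of_nonneg_right (le_max_right _ _) (by positivity)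
    have e2 : max 1 D * (a + b) ≤ max 1 D * (2 * max a b) := by
      apply mul_le_mul_of_nonneg_left _ (zero_le_one.trans (le_max_left _ _))
      linarith [le_max_left a b, le_max_right a b]
    linarith
  have h2 : (max a b) ^ p ≤ a ^ p + b ^ p := by
    have := Real.rpow_nonneg ha p
    have := Real.rpow_nonneg hb p
    rcases max_choice a b with h | h <;> rw [h] <;> linarith
  calc x ^ p ≤ ((2 * max 1 D) * max a b) ^ p := Real.rpow_le_rpow hx h1 hp0
    _ = (2 * max 1 D) ^ p * (max a b) ^ p :=
        Real.mul_rpow (by linarith) (ha.trans (le_max_left _ _))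
    _ ≤ (2 * max 1 D) ^ P * (a ^ p + b ^ p) :=
        mul_le_mul (Real.rpow_le_rpow_of_exponent_le hM hpP) h2
          (Real.rpow_nonneg (ha.trans (le_max_left _ _)) _)
          (Real.rpow_nonneg (by linarith) _)

lemma memLpVar_of_norm_le {F F₁ F₂ : Type*} [NormedAddCommGroup F] [NormedAddCommGroup F₁]
    [NormedAddCommGroup F₂] (hΩ : IsOpen Ω) (hpm : AEMeasurable p (volume.restrict Ω))
    (hp1 : ∀ x ∈ Ω, 1 ≤ p x) (hP : ∀ x ∈ Ω, p x ≤ P) {u : (𝔼 N) → F} {a : (𝔼 N) → F₁}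
    {b : (𝔼 N) → F₂} (hu : AEStronglyMeasurable u (volume.restrict Ω)) (ha : MemLpVar Ω p a)
    (hb : MemLpVar Ω p b) {D : ℝ}
    (h : ∀ᵐ x ∂volume.restrict Ω, ‖u x‖ ≤ D * (‖a x‖ + ‖b x‖)) : MemLpVar Ω p u := by
  refine ⟨hu, ((ha.2.add hb.2).const_mul ((2 * max 1 D) ^ P)).mono'
    (hu.norm.aemeasurable.pow hpm).aestronglyMeasurable ?_⟩
  filter_upwards [h, ae_restrict_mem hΩ.measurableSet] with x hx hxΩ
  rw [Real.norm_of_nonneg (Real.rpow_nonneg (norm_nonneg _) _)]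
  exact rpow_le_of_le_mul_add (hp1 x hxΩ) (hP x hxΩ) (norm_nonneg _) (norm_nonneg _)
    (norm_nonneg _) hx

lemma MemLpVar.memLpVar_one {F : Type*} [NormedAddCommGroup F] (hΩ : IsOpen Ω)
    (hfin : volume Ω ≠ ⊤) (hp1 : ∀ x ∈ Ω, 1 ≤ p x) {u : (𝔼 N) → F} (hu : MemLpVar Ω p u) :
    MemLpVar Ω (fun _ => 1) u := by
  rw [memLpVar_one_iff]
  have hc : IntegrableOn (fun _ : 𝔼 N => (1 : ℝ)) Ω := integrableOn_const hfin
  refine (hc.add hu.2).mono' hu.1 ?_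
  filter_upwards [ae_restrict_mem hΩ.measurableSet] with x hx
  simp only [Pi.add_apply]
  rcases le_total ‖u x‖ 1 with h | h
  · have := Real.rpow_nonneg (norm_nonneg (u x)) (p x)
    linarith
  · have := Real.rpow_le_rpow_of_exponent_le h (hp1 x hx)
    rw [Real.rpow_one] at this
    linarith

/-- Admissibility of a test function dominated by a function in `𝐖`. -/
lemma memW_of_bound (hΩ : IsOpen Ω) (hfin : volume Ω ≠ ⊤)
    (hpm : AEMeasurable p (volume.restrict Ω)) (hp1 : ∀ x ∈ Ω, 1 ≤ p x)
    (hP : ∀ x ∈ Ω, p x ≤ P) {v w φ : (𝔼 N) → ℝ} {G B H : (𝔼 N) → 𝔼 N}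
    (hv : MemW Ω p q v G) (hw : MemW1 Ω p w B) {C D : ℝ} (hC : 0 ≤ C)
    (hφ : HasWeakGradient Ω φ H) (h0 : ∀ᵐ x ∂volume.restrict Ω, 0 ≤ φ x)
    (h1 : ∀ᵐ x ∂volume.restrict Ω, φ x ≤ C * v x)
    (h2 : ∀ᵐ x ∂volume.restrict Ω, ‖H x‖ ≤ D * (‖G x‖ + ‖B x‖)) : MemW Ω p q φ H := by
  have hφm := hφ.1.aestronglyMeasurable
  have hHm := hφ.2.1.aestronglyMeasurable
  have hφv : ∀ᵐ x ∂volume.restrict Ω, ‖φ x‖ ≤ C * (‖v x‖ + ‖v x‖) := by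
    filter_upwards [h0, h1] with x hx hx'
    rw [Real.norm_of_nonneg hx]
    have e1 := le_abs_self (v x)
    have e2 := mul_le_mul_of_nonneg_left e1 hC
    have e3 : 0 ≤ C * |v x| := by positivity
    rw [Real.norm_eq_abs]; linarith
  have hB1 := hw.2.1.memLpVar_one hΩ hfin hp1
  -- Zero boundary values come from `0 ≤ φ ≤ C v`; the gradient bound by `G` and `B` is needed only
  -- for integrability.
  refine ⟨hv.1.of_le hΩ ⟨?_, ?_, hφ⟩ hC h0 h1, ⟨?_, ?_, hφ⟩, ?_⟩
  · exact memLpVar_of_norm_le hΩ aemeasurable_const (fun _ _ => le_rfl) (fun _ _ => le_rfl)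
      hφm hv.1.1.1 hv.1.1.1 hφv
  · exact memLpVar_of_norm_le hΩ aemeasurable_const (fun _ _ => le_rfl) (fun _ _ => le_rfl)
      hHm hv.1.1.2.1 hB1 h2
  · exact memLpVar_of_norm_le hΩ hpm hp1 hP hφm hv.2.1.1 hv.2.1.1 hφv
  · exact memLpVar_of_norm_le hΩ hpm hp1 hP hHm hv.2.1.2.1 hw.2.1 h2
  · refine hv.2.2.of_le_mul hφm (c := 2 * C) ?_
    filter_upwards [hφv] with x hx
    linarith

/-- Admissibility of the truncated Picone test functions. -/
lemma memW_piconeTest (hΩ : IsOpen Ω) (hfin : volume Ω ≠ ⊤)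
    (hpm : AEMeasurable p (volume.restrict Ω)) (hp1 : ∀ x ∈ Ω, 1 ≤ p x)
    (hP : ∀ x ∈ Ω, p x ≤ P) (hq : 1 < q) {v w : (𝔼 N) → ℝ} {G B : (𝔼 N) → 𝔼 N}
    (hv : MemW Ω p q v G) (hw : MemW1 Ω p w B) (hv0 : ∀ᵐ x ∂volume.restrict Ω, 0 < v x)
    (hw0 : ∀ᵐ x ∂volume.restrict Ω, 0 < w x) {k ε : ℝ} (hk : 0 < k) (hε : 0 < ε)
    {A' B' : (𝔼 N) → 𝔼 N} (hA' : ∀ x, A' x = if v x ≤ k then G x else 0)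
    (hB' : ∀ x, B' x = if min (v x) k ≤ w x then A' x else B x) :
    MemW Ω p q (fun x => piconeTest q (min (v x) k + ε) (min (min (v x) k) (w x) + ε))
        (fun x => piconeGrad q (min (v x) k + ε) (min (min (v x) k) (w x) + ε) (A' x) (B' x)) ∧
      MemW Ω p q (fun x => -piconeTest q (min (min (v x) k) (w x) + ε) (min (v x) k + ε))
        (fun x => -piconeGrad q (min (min (v x) k) (w x) + ε) (min (v x) k + ε)
          (B' x) (A' x)) := by
  have hconst : ∀ c : ℝ, HasWeakGradient Ω (fun _ : 𝔼 N => c) (fun _ => 0) := fun c => by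
    have := hasWeakGradient_of_contDiff (Ω := Ω) (contDiff_const (c := c) (n := 1) (𝕜 := ℝ)
      (E := 𝔼 N))
    simpa using this
  have hA'f : A' = fun x => if v x ≤ k then G x else 0 := funext hA'
  have hB'f : B' = fun x => if min (v x) k ≤ w x then A' x else B x := funext hB'
  have hmin : HasWeakGradient Ω (fun x => min (v x) k) A' := by
    rw [hA'f]; exact hv.2.1.2.2.min hΩ (hconst k)
  have hmin2 : HasWeakGradient Ω (fun x => min (min (v x) k) (w x)) B' := by
    rw [hB'f]; exact hmin.min hΩ hw.2.2
  have hs : HasWeakGradient Ω (fun x => min (v x) k + ε) A' := by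
    simpa using hmin.add hΩ (hconst ε)
  have hm : HasWeakGradient Ω (fun x => min (min (v x) k) (w x) + ε) B' := by
    simpa using hmin2.add hΩ (hconst ε)
  have hsb : ∀ᵐ x ∂volume.restrict Ω, min (v x) k + ε ∈ Set.Icc ε (k + ε) := by
    filter_upwards [hv0] with x hx
    have h1 : 0 < min (v x) k := by positivity
    exact ⟨by linarith, by linarith [min_le_right (v x) k]⟩
  have hmb : ∀ᵐ x ∂volume.restrict Ω, min (min (v x) k) (w x) + ε ∈ Set.Icc ε (k + ε) := by
    filter_upwards [hv0, hw0] with x hx hx'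
    have h1 : 0 < min (min (v x) k) (w x) := by positivity
    exact ⟨by linarith, by linarith [min_le_right (v x) k, min_le_left (min (v x) k) (w x)]⟩
  set R := 1 + (q - 1) * ((k + ε) / ε) ^ q + q * ((k + ε) / ε) ^ (q - 1)
  have hR0 : 0 ≤ R := by
    have : 0 ≤ q - 1 := by linarith
    have : 0 ≤ q := by linarith
    positivity
  have hAB : ∀ x, ‖A' x‖ + ‖B' x‖ ≤ 2 * (‖G x‖ + ‖B x‖) := fun x => by
    have e1 : ‖A' x‖ ≤ ‖G x‖ := by
      rw [hA' x]; split_ifs <;> simp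
    have e2 : ‖B' x‖ ≤ ‖A' x‖ + ‖B x‖ := by
      rw [hB' x]; split_ifs <;> simp
    linarith [norm_nonneg (B x)]
  have hq0 : 0 ≤ q := by linarith
  constructor
  · refine memW_of_bound hΩ hfin hpm hp1 hP hv hw (C := q) (D := R * 2) hq0
      (hs.sub_rpow_mul_rpow hΩ hm q hε hsb hmb) ?_ ?_ ?_
    · filter_upwards [hv0, hw0] with x hx hx'
      exact piconeTest_trunc_nonneg hq hx hx' hk hε
    · filter_upwards [hv0, hw0] with x hx hx'
      exact piconeTest_trunc_le hq hx hx' hk hε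
    · filter_upwards [hsb, hmb] with x hx hx'
      refine (norm_piconeGrad_le hq hε hx hx' _ _).trans ?_
      rw [mul_assoc]
      exact mul_le_mul_of_nonneg_left (hAB x) hR0
  · have hneg := (hm.sub_rpow_mul_rpow hΩ hs q hε hmb hsb).const_mul (-1)
    simp only [neg_one_smul, neg_one_mul] at hneg
    refine memW_of_bound hΩ hfin hpm hp1 hP hv hw (C := ((k + ε) / ε) ^ (q - 1) * q)
      (D := R * 2) (by positivity) hneg ?_ ?_ ?_
    · filter_upwards [hv0, hw0] with x hx hx'
      exact neg_piconeTest_trunc_nonneg hq hx hx' hk hε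
    · filter_upwards [hv0, hw0] with x hx hx'
      exact neg_piconeTest_trunc_le hq hx hx' hk hε
    · filter_upwards [hsb, hmb] with x hx hx'
      rw [norm_neg]
      refine (norm_piconeGrad_le hq hε hx' hx _ _).trans ?_
      rw [mul_assoc, add_comm ‖B' x‖]
      exact mul_le_mul_of_nonneg_left (hAB x) hR0

lemma integrableOn_inner_flux (hΩ : IsOpen Ω) (hpm : AEMeasurable p (volume.restrict Ω))
    (hp1 : ∀ x ∈ Ω, 1 < p x) {A B : (𝔼 N) → 𝔼 N} (hA : MemLpVar Ω p A) (hB : MemLpVar Ω p B) :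
    IntegrableOn (fun x => inner ℝ (‖A x‖ ^ (p x - 2) • A x) (B x)) Ω := by
  have hm : AEStronglyMeasurable (fun x => inner ℝ (‖A x‖ ^ (p x - 2) • A x) (B x))
      (volume.restrict Ω) :=
    ((hA.1.norm.aemeasurable.pow (hpm.sub_const 2)).aestronglyMeasurable.smul hA.1).inner hB.1
  refine (hA.2.add hB.2).mono' hm ?_
  filter_upwards [ae_restrict_mem hΩ.measurableSet] with x hx
  exact (abs_inner_rpow_smul_le (hp1 x hx) _ _).trans
    (rpow_sub_one_mul_le (hp1 x hx) (norm_nonneg _) (norm_nonneg _))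

lemma integrableOn_norm_rpow_mul_norm (hΩ : IsOpen Ω) (hpm : AEMeasurable p (volume.restrict Ω))
    (hp1 : ∀ x ∈ Ω, 1 < p x) {A B : (𝔼 N) → 𝔼 N} (hA : MemLpVar Ω p A) (hB : MemLpVar Ω p B) :
    IntegrableOn (fun x => ‖A x‖ ^ (p x - 1) * ‖B x‖) Ω := by
  refine (hA.2.add hB.2).mono' ((hA.1.norm.aemeasurable.pow
    (hpm.sub_const 1)).aestronglyMeasurable.mul hB.1.norm) ?_
  filter_upwards [ae_restrict_mem hΩ.measurableSet] with x hx
  rw [Real.norm_of_nonneg (by positivity)]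
  exact rpow_sub_one_mul_le (hp1 x hx) (norm_nonneg _) (norm_nonneg _)

end Membership

/-! ### Pointwise estimates for the mass and reaction terms. -/

section Pointwise

variable {q v w φ ψ : ℝ}

lemma rpow_two_mul_sub_one (hv : 0 < v) : v ^ (2 * q - 1) = v ^ q * v ^ (q - 1) := by
  rw [← Real.rpow_add hv]; congr 1; ring

/-- With `α = v^(q-1) φ` and `β = w^(q-1) ψ`, the right side is `v^q α - w^q β`, and `β ≤ α`. -/
lemma mass_lower_bound (hv : 0 < v) (hw : 0 < w)
    (hβα : w ^ (q - 1) * ψ ≤ v ^ (q - 1) * φ) :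
    (v ^ q - w ^ q) * (v ^ (q - 1) * φ) ≤ v ^ (2 * q - 1) * φ - w ^ (2 * q - 1) * ψ := by
  rw [rpow_two_mul_sub_one hv, rpow_two_mul_sub_one hw]
  have := mul_le_mul_of_nonneg_left hβα (Real.rpow_nonneg hw.le q)
  linarith

lemma mass_le (hq : 1 < q) (hv : 0 < v) (hw : 0 < w) (hφ : 0 ≤ φ)
    (hz : v ≤ w → ψ = 0) (hβα : w ^ (q - 1) * ψ ≤ v ^ (q - 1) * φ) :
    w ^ (2 * q - 1) * ψ ≤ v ^ (2 * q - 1) * φ := by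
  rw [rpow_two_mul_sub_one hv, rpow_two_mul_sub_one hw]
  rcases le_or_gt v w with h | h
  · rw [hz h, mul_zero]; positivity
  · rw [mul_assoc, mul_assoc]
    refine (mul_le_mul_of_nonneg_left hβα (Real.rpow_nonneg hw.le q)).trans ?_
    exact mul_le_mul_of_nonneg_right (Real.rpow_le_rpow hw.le h.le (by linarith)) (by positivity)

/-- Where `w < v`, monotonicity replaces `F w / w^(q-1)` by the smaller `F v / v^(q-1)`. The factor
`F v * v` is isolated since its integrability follows from testing with `v` itself, while the
remaining quotient is bounded. -/
lemma reaction_upper_bound {F : ℝ → ℝ}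
    (hF : AntitoneOn (fun s : ℝ => F s / s ^ (q - 1)) (Set.Ioi 0)) (hv : 0 < v) (hw : 0 < w)
    (hψ : 0 ≤ ψ) (hz : v ≤ w → φ = 0 ∧ ψ = 0) :
    F v * φ - F w * ψ
      ≤ F v * v * ((v ^ (q - 1) * φ - w ^ (q - 1) * ψ) / v ^ q) := by
  rcases le_or_gt v w with h | h
  · obtain ⟨h1, h2⟩ := hz h
    simp [h1, h2]
  · have h0 := hF hw hv h.le
    dsimp only at h0
    have hv1 : 0 < v ^ (q - 1) := by positivity
    have hw1 : 0 < w ^ (q - 1) := by positivity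
    have e1 : v ^ q = v ^ (q - 1) * v := by
      rw [← Real.rpow_add_one hv.ne']; congr 1; ring
    have e2 : F v * v * ((v ^ (q - 1) * φ - w ^ (q - 1) * ψ) / v ^ q)
        = F v * φ - F v / v ^ (q - 1) * (w ^ (q - 1) * ψ) := by
      rw [e1]; field_simp
    have e3 : F w * ψ = F w / w ^ (q - 1) * (w ^ (q - 1) * ψ) := by field_simp
    rw [e2, e3]
    have := mul_le_mul_of_nonneg_right h0 (by positivity : 0 ≤ w ^ (q - 1) * ψ)
    linarith

end Pointwise

/-! ### The regularized comparison inequality. -/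

section Comparison

variable {p : (𝔼 N) → ℝ} {P q lam : ℝ} {h : (𝔼 N) → ℝ} {f : (𝔼 N) → ℝ → ℝ} {v w : (𝔼 N) → ℝ}
  {G B : (𝔼 N) → 𝔼 N}

/-- The common value `v ^ (q - 1) * φ` for the truncated Picone test function `φ`. -/
noncomputable def upperWeight (q k ε v w : ℝ) : ℝ :=
  v ^ (q - 1) * piconeTest q (min v k + ε) (min (min v k) w + ε)

/-- The analogue `w ^ (q - 1) * ψ` of `upperWeight` for the supersolution. -/
noncomputable def lowerWeight (q k ε v w : ℝ) : ℝ :=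
  w ^ (q - 1) * -piconeTest q (min (min v k) w + ε) (min v k + ε)

lemma upperWeight_nonneg {q k ε v w : ℝ} (hq : 1 < q) (hv : 0 < v) (hw : 0 < w) (hk : 0 < k)
    (hε : 0 < ε) : 0 ≤ upperWeight q k ε v w :=
  mul_nonneg (by positivity) (piconeTest_trunc_nonneg hq hv hw hk hε)

lemma lowerWeight_nonneg {q k ε v w : ℝ} (hq : 1 < q) (hv : 0 < v) (hw : 0 < w) (hk : 0 < k)
    (hε : 0 < ε) : 0 ≤ lowerWeight q k ε v w :=
  mul_nonneg (by positivity) (neg_piconeTest_trunc_nonneg hq hv hw hk hε)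

lemma lowerWeight_le_upperWeight {q k ε v w : ℝ} (hq : 1 < q) (hv : 0 < v) (hw : 0 < w)
    (hk : 0 < k) (hε : 0 < ε) : lowerWeight q k ε v w ≤ upperWeight q k ε v w :=
  rpow_mul_neg_piconeTest_le hq hv hw hk hε

lemma upperWeight_le {q k ε v w : ℝ} (hq : 1 < q) (hv : 0 < v) (hw : 0 < w) (hk : 0 < k)
    (hε : 0 < ε) : upperWeight q k ε v w ≤ q * v ^ q := by
  have e1 : v ^ q = v ^ (q - 1) * v := by
    rw [← Real.rpow_add_one hv.ne']; congr 1; ring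
  rw [e1]
  calc _ ≤ v ^ (q - 1) * (q * v) :=
        mul_le_mul_of_nonneg_left (piconeTest_trunc_le hq hv hw hk hε) (by positivity)
    _ = _ := by ring

lemma neg_piconeTest_trunc_eq_zero {q k ε v w : ℝ} (hv : 0 < v) (hw : 0 < w) (hk : 0 < k)
    (hε : 0 < ε) (hvw : v ≤ w) :
    -piconeTest q (min (min v k) w + ε) (min v k + ε) = 0 := by
  rw [neg_piconeTest_trunc_eq hv hw hk hε, piconeTest_trunc_eq_zero hv hk hε hvw, mul_zero]

/-- The weight vanishes where `v ≤ w`, and elsewhere `0 ≤ v^q - w^q ≤ v^q`; hence a dominating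
function free of `w`. -/
lemma abs_weight_le {q k ε v w : ℝ} (hq : 1 < q) (hv : 0 < v) (hw : 0 < w) (hk : 0 < k)
    (hε : 0 < ε) : |(v ^ q - w ^ q) * upperWeight q k ε v w| ≤ q * v ^ (2 * q) := by
  have e : v ^ (2 * q) = v ^ q * v ^ q := by
    rw [← Real.rpow_add hv]; congr 1; ring
  have hq0 : 0 ≤ q := by linarith
  rcases le_or_gt v w with h | h
  · rw [upperWeight, piconeTest_trunc_eq_zero hv hk hε h]
    simp only [mul_zero, abs_zero]
    positivity
  · have h1 : w ^ q ≤ v ^ q := Real.rpow_le_rpow hw.le h.le hq0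
    have h2 : 0 ≤ w ^ q := by positivity
    have h3 := upperWeight_nonneg hq hv hw hk hε
    have h4 := upperWeight_le hq hv hw hk hε
    rw [abs_of_nonneg (mul_nonneg (by linarith) h3), e]
    calc _ ≤ v ^ q * (q * v ^ q) := mul_le_mul (by linarith) h4 h3 (by positivity)
      _ = _ := by ring

lemma measurable_piconeTest (q : ℝ) : Measurable fun z : ℝ × ℝ => piconeTest q z.1 z.2 := by
  unfold piconeTest
  fun_prop

/-- The integral inequality obtained by testing the sub- and the supersolution inequality with the
truncated Picone test functions. -/
lemma comparison_inequality (hΩ : IsOpen Ω) (hfin : volume Ω ≠ ⊤)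
    (hpm : AEMeasurable p (volume.restrict Ω)) (hqp : ∀ x ∈ Ω, q ≤ p x)
    (hP : ∀ x ∈ Ω, p x ≤ P) (hq : 1 < q) (hlam : 0 < lam)
    (hh : AEStronglyMeasurable h (volume.restrict Ω))
    (hhv : IntegrableOn (fun x => h x * v x ^ q) Ω)
    (hh0 : ∀ᵐ x ∂volume.restrict Ω, 0 ≤ h x) (hf3 : CondF3 Ω q f)
    (hv : MemW Ω p q v G) (hw : MemW1 Ω p w B)
    (hv2 : IntegrableOn (fun x => v x ^ (2 * q)) Ω)
    (hfv : IntegrableOn (fun x => f x (v x) * v x) Ω)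
    (hv0 : ∀ᵐ x ∂volume.restrict Ω, 0 < v x)
    (hw0 : ∀ᵐ x ∂volume.restrict Ω, 0 < w x)
    (hsub : ∀ φ H, MemW Ω p q φ H → (∀ᵐ x ∂volume.restrict Ω, 0 ≤ φ x) →
      IntegrableOn (fun x => f x (v x) * φ x) Ω ∧
      weakLHS Ω p q lam v G φ H ≤ weakRHS Ω q lam h f v φ)
    (hsup : ∀ φ H, MemW Ω p q φ H → (∀ᵐ x ∂volume.restrict Ω, 0 ≤ φ x) →
      IntegrableOn (fun x => f x (w x) * φ x) Ω ∧
      weakRHS Ω q lam h f w φ ≤ weakLHS Ω p q lam w B φ H)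
    {k ε : ℝ} (hk : 0 < k) (hε : 0 < ε) :
    ∫ x in Ω, (v x ^ q - w x ^ q) * upperWeight q k ε (v x) (w x) ≤
      (lam * ∫ x in Ω, if k < v x then q * (‖G x‖ ^ (p x - 1) * ‖B x‖) else 0)
      + (∫ x in Ω, h x * (upperWeight q k ε (v x) (w x) - lowerWeight q k ε (v x) (w x)))
      + lam * ∫ x in Ω, f x (v x) * v x *
          ((upperWeight q k ε (v x) (w x) - lowerWeight q k ε (v x) (w x)) / v x ^ q) := by
  have hp1 : ∀ x ∈ Ω, 1 < p x := fun x hx => hq.trans_le (hqp x hx)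
  have hp1' : ∀ x ∈ Ω, 1 ≤ p x := fun x hx => (hp1 x hx).le
  have hvm : AEMeasurable v (volume.restrict Ω) := hv.2.1.1.1.aemeasurable
  have hwm : AEMeasurable w (volume.restrict Ω) := hw.1.1.aemeasurable
  let A' : (𝔼 N) → 𝔼 N := fun x => if v x ≤ k then G x else 0
  let B' : (𝔼 N) → 𝔼 N := fun x => if min (v x) k ≤ w x then A' x else B x
  obtain ⟨hφ, hψ⟩ := memW_piconeTest hΩ hfin hpm hp1' hP hq hv hw hv0 hw0 hk hε
    (A' := A') (B' := B') (fun _ => rfl) (fun _ => rfl)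
  set φ : (𝔼 N) → ℝ := fun x => piconeTest q (min (v x) k + ε) (min (min (v x) k) (w x) + ε)
  set Hφ : (𝔼 N) → 𝔼 N := fun x =>
    piconeGrad q (min (v x) k + ε) (min (min (v x) k) (w x) + ε) (A' x) (B' x) with hHφ
  set ψ : (𝔼 N) → ℝ := fun x => -piconeTest q (min (min (v x) k) (w x) + ε) (min (v x) k + ε)
  set Hψ : (𝔼 N) → 𝔼 N := fun x =>
    -piconeGrad q (min (min (v x) k) (w x) + ε) (min (v x) k + ε) (B' x) (A' x) with hHψ
  have hφ0 : ∀ᵐ x ∂volume.restrict Ω, 0 ≤ φ x := by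
    filter_upwards [hv0, hw0] with x hx hx' using piconeTest_trunc_nonneg hq hx hx' hk hε
  have hψ0 : ∀ᵐ x ∂volume.restrict Ω, 0 ≤ ψ x := by
    filter_upwards [hv0, hw0] with x hx hx' using neg_piconeTest_trunc_nonneg hq hx hx' hk hε
  obtain ⟨i7, s1⟩ := hsub φ Hφ hφ hφ0
  obtain ⟨i8, s2⟩ := hsup ψ Hψ hψ hψ0
  have hφm : AEMeasurable φ (volume.restrict Ω) := hφ.2.1.1.1.aemeasurable
  have hψm : AEMeasurable ψ (volume.restrict Ω) := hψ.2.1.1.1.aemeasurable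
  have hφeq : ∀ x, v x ^ (q - 1) * φ x = upperWeight q k ε (v x) (w x) := fun x => rfl
  have hψeq : ∀ x, w x ^ (q - 1) * ψ x = lowerWeight q k ε (v x) (w x) := fun x => rfl
  have hα : AEMeasurable (fun x => upperWeight q k ε (v x) (w x)) (volume.restrict Ω) :=
    (hvm.pow_const _).mul hφm
  have hβ : AEMeasurable (fun x => lowerWeight q k ε (v x) (w x)) (volume.restrict Ω) :=
    (hwm.pow_const _).mul hψm
  have hz : ∀ᵐ x ∂volume.restrict Ω, v x ≤ w x → φ x = 0 ∧ ψ x = 0 := by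
    filter_upwards [hv0, hw0] with x hx hx' hxx
    exact ⟨piconeTest_trunc_eq_zero hx hk hε hxx,
      neg_piconeTest_trunc_eq_zero hx hx' hk hε hxx⟩
  have i1 : IntegrableOn (fun x => v x ^ (2 * q - 1) * φ x) Ω := by
    refine (hv2.const_mul q).mono' ((hvm.pow_const _).mul hφm).aestronglyMeasurable ?_
    filter_upwards [hv0, hw0, hφ0] with x hx hx' hxφ
    rw [Real.norm_of_nonneg (by positivity), rpow_two_mul_sub_one hx, mul_assoc, hφeq]
    calc _ ≤ v x ^ q * (q * v x ^ q) :=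
          mul_le_mul_of_nonneg_left (upperWeight_le hq hx hx' hk hε) (by positivity)
      _ = q * (v x ^ q * v x ^ q) := by ring
      _ = _ := by rw [← Real.rpow_add hx]; congr 2; ring
  -- The supersolution's mass term is dominated by the subsolution's, because `ψ` vanishes where `v
  -- ≤ w`.
  have i2 : IntegrableOn (fun x => w x ^ (2 * q - 1) * ψ x) Ω := by
    refine i1.mono' ((hwm.pow_const _).mul hψm).aestronglyMeasurable ?_
    filter_upwards [hv0, hw0, hφ0, hψ0, hz] with x hx hx' hxφ hxψ hxz
    rw [Real.norm_of_nonneg (by positivity)]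
    exact mass_le hq hx hx' hxφ (fun hh => (hxz hh).2)
      (lowerWeight_le_upperWeight hq hx hx' hk hε)
  have i3 : IntegrableOn (fun x => h x * upperWeight q k ε (v x) (w x)) Ω := by
    refine (hhv.const_mul q).mono' (hh.mul hα.aestronglyMeasurable) ?_
    filter_upwards [hv0, hw0, hh0] with x hx hx' hxh
    rw [Real.norm_of_nonneg (mul_nonneg hxh (upperWeight_nonneg hq hx hx' hk hε))]
    calc _ ≤ h x * (q * v x ^ q) :=
          mul_le_mul_of_nonneg_left (upperWeight_le hq hx hx' hk hε) hxh
      _ = _ := by ring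
  have i4 : IntegrableOn (fun x => h x * lowerWeight q k ε (v x) (w x)) Ω := by
    refine i3.mono' (hh.mul hβ.aestronglyMeasurable) ?_
    filter_upwards [hv0, hw0, hh0] with x hx hx' hxh
    rw [Real.norm_of_nonneg (mul_nonneg hxh (lowerWeight_nonneg hq hx hx' hk hε))]
    exact mul_le_mul_of_nonneg_left (lowerWeight_le_upperWeight hq hx hx' hk hε) hxh
  have i5 := integrableOn_inner_flux hΩ hpm hp1 hv.2.1.2.1 hφ.2.1.2.1
  have i6 := integrableOn_inner_flux hΩ hpm hp1 hw.2.1 hψ.2.1.2.1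
  have iE : IntegrableOn (fun x => if k < v x then q * (‖G x‖ ^ (p x - 1) * ‖B x‖) else 0) Ω := by
    have h1 := (integrableOn_norm_rpow_mul_norm hΩ hpm hp1 hv.2.1.2.1 hw.2.1).const_mul q
    have hs : NullMeasurableSet {x | k < v x} (volume.restrict Ω) :=
      nullMeasurableSet_lt aemeasurable_const hvm
    refine (Integrable.indicator₀ h1 hs).congr (Eventually.of_forall fun x => ?_)
    by_cases hx : k < v x <;> simp [hx]
  have iL : IntegrableOn (fun x => (v x ^ q - w x ^ q) * upperWeight q k ε (v x) (w x)) Ω := by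
    refine (hv2.const_mul q).mono'
      (((hvm.pow_const _).sub (hwm.pow_const _)).mul hα).aestronglyMeasurable ?_
    filter_upwards [hv0, hw0] with x hx hx' using abs_weight_le hq hx hx' hk hε
  have iJ : IntegrableOn (fun x => f x (v x) * v x *
      ((upperWeight q k ε (v x) (w x) - lowerWeight q k ε (v x) (w x)) / v x ^ q)) Ω := by
    refine hfv.mul_bdd (c := q)
      ((hα.sub hβ).div (hvm.pow_const _)).aestronglyMeasurable ?_
    filter_upwards [hv0, hw0] with x hx hx'
    have e1 := lowerWeight_le_upperWeight hq hx hx' hk hε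
    have e2 := lowerWeight_nonneg hq hx hx' hk hε
    have e3 := upperWeight_le hq hx hx' hk hε
    have e4 : 0 < v x ^ q := by positivity
    rw [Real.norm_of_nonneg (div_nonneg (by linarith) e4.le)]
    exact (div_le_iff₀ e4).2 (by linarith)
  have c1 : ∫ x in Ω, (v x ^ q - w x ^ q) * upperWeight q k ε (v x) (w x) ≤
      (∫ x in Ω, v x ^ (2 * q - 1) * φ x) - ∫ x in Ω, w x ^ (2 * q - 1) * ψ x := by
    rw [← integral_sub i1 i2]
    refine integral_mono_ae iL (i1.sub i2) ?_
    filter_upwards [hv0, hw0] with x hx hx'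
    exact mass_lower_bound hx hx' (lowerWeight_le_upperWeight hq hx hx' hk hε)
  have c2 : -(∫ x in Ω, if k < v x then q * (‖G x‖ ^ (p x - 1) * ‖B x‖) else 0) ≤
      (∫ x in Ω, inner ℝ (‖G x‖ ^ (p x - 2) • G x) (Hφ x))
        - ∫ x in Ω, inner ℝ (‖B x‖ ^ (p x - 2) • B x) (Hψ x) := by
    rw [← integral_sub i5 i6, ← integral_neg]
    refine integral_mono_ae iE.neg (i5.sub i6) ?_
    filter_upwards [hv0, hw0, ae_restrict_mem hΩ.measurableSet] with x hx hx' hxΩ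
    have := energy_lower_bound hq (hqp x hxΩ) hx hx' hk hε (G x) (B x) (A' := A' x) (B' := B' x)
      rfl rfl
    simpa only [hHφ, hHψ, inner_neg_right, sub_neg_eq_add] using this
  have c3 : (∫ x in Ω, h x * (upperWeight q k ε (v x) (w x) - lowerWeight q k ε (v x) (w x)))
      = (∫ x in Ω, h x * v x ^ (q - 1) * φ x) - ∫ x in Ω, h x * w x ^ (q - 1) * ψ x := by
    simp only [mul_assoc, hφeq, hψeq]
    rw [← integral_sub i3 i4]
    simp only [mul_sub]
  have c4 : (∫ x in Ω, f x (v x) * φ x) - ∫ x in Ω, f x (w x) * ψ x ≤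
      ∫ x in Ω, f x (v x) * v x *
          ((upperWeight q k ε (v x) (w x) - lowerWeight q k ε (v x) (w x)) / v x ^ q) := by
    rw [← integral_sub i7 i8]
    refine integral_mono_ae (i7.sub i8) iJ ?_
    filter_upwards [hv0, hw0, hψ0, hz, ae_restrict_mem hΩ.measurableSet] with x hx hx' hxψ hxz hxΩ
    exact reaction_upper_bound (hf3 x hxΩ) hx hx' hxψ hxz
  simp only [weakLHS, weakRHS] at s1 s2
  have c2' := mul_le_mul_of_nonneg_left c2 hlam.le
  have c4' := mul_le_mul_of_nonneg_left c4 hlam.le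
  rw [c3]
  linarith

/-- Both weights have the same limit: if `w ≤ v`, the factor `w^(q-1)` cancels against `(min v
w)^(1-q)`; if `v ≤ w`, both limits are zero. Hence the `h` and reaction remainders disappear. -/
lemma tendsto_weights (q : ℝ) {v w : ℝ} (hv : 0 < v) (hw : 0 < w) :
    Tendsto (fun n : ℕ => upperWeight q ((n : ℝ) + 1) (1 / ((n : ℝ) + 1)) v w) atTop
      (𝓝 (v ^ q - (min v w) ^ q)) ∧
    Tendsto (fun n : ℕ => upperWeight q ((n : ℝ) + 1) (1 / ((n : ℝ) + 1)) v w
      - lowerWeight q ((n : ℝ) + 1) (1 / ((n : ℝ) + 1)) v w) atTop (𝓝 0) := by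
  have hmin : 0 < min v w := lt_min hv hw
  obtain ⟨h1, h2⟩ := tendsto_truncation (v := v) (w := w)
  have hα : Tendsto (fun n : ℕ => upperWeight q ((n : ℝ) + 1) (1 / ((n : ℝ) + 1)) v w) atTop
      (𝓝 (v ^ q - (min v w) ^ q)) := by
    have := (tendsto_piconeTest (q := q) hv hmin h1 h2).const_mul (v ^ (q - 1))
    rwa [rpow_mul_piconeTest hv] at this
  refine ⟨hα, ?_⟩
  have hβ : Tendsto (fun n : ℕ => lowerWeight q ((n : ℝ) + 1) (1 / ((n : ℝ) + 1)) v w) atTop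
      (𝓝 (v ^ q - (min v w) ^ q)) := by
    have := (tendsto_piconeTest (q := q) hmin hv h2 h1).neg.const_mul (w ^ (q - 1))
    have e : w ^ (q - 1) * -piconeTest q (min v w) v = v ^ q - (min v w) ^ q := by
      rcases le_total v w with hvw | hvw
      · rw [min_eq_left hvw, piconeTest_eq hv]; simp
      · rw [min_eq_right hvw, mul_neg, rpow_mul_piconeTest hw, neg_sub]
    rwa [e] at this
  simpa using hα.sub hβ

end Comparison

end VarExp

/-! ### Passage to the limit and conclusion. -/

open VarExp

theorem mainTheorem10 {N : ℕ} (hN : 1 ≤ N)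
    (Ω : Set (EuclideanSpace ℝ (Fin N))) (hΩopen : IsOpen Ω) (hΩconn : IsConnected Ω)
    (hΩbdd : Bornology.IsBounded Ω)
    (p : EuclideanSpace ℝ (Fin N) → ℝ) (hpC1 : ContDiffOn ℝ 1 p (closure Ω))
    (hp1 : ∀ x ∈ closure Ω, 1 < p x)
    (q : ℝ) (hq1 : 1 < q) (hqp : ∀ x ∈ closure Ω, q ≤ p x)
    (lam : ℝ) (hlam : 0 < lam)
    (p₀ : ℝ≥0∞) (hp₀ : 2 ≤ p₀)
    (h : EuclideanSpace ℝ (Fin N) → ℝ) (hh : MemLp h p₀ (volume.restrict Ω))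
    (hhnonneg : ∀ᵐ x ∂volume.restrict Ω, 0 ≤ h x)
    (f : EuclideanSpace ℝ (Fin N) → ℝ → ℝ)
    (hf1 : VarExp.CondF1 Ω f) (hf3 : VarExp.CondF3 Ω q f)
    (v vt : EuclideanSpace ℝ (Fin N) → ℝ)
    (hv : VarExp.IsWeakSubsolution Ω p q lam h f v)
    (hvt : VarExp.IsWeakSupersolution Ω p q lam h f vt) :
    ∀ᵐ x ∂volume.restrict Ω, v x ≤ vt x := by
  obtain ⟨hv0, G, hvW, hsub⟩ := hv
  obtain ⟨hw0, B, ⟨hwW, -⟩, hsup⟩ := hvt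
  have hq0 : 0 < q := by linarith
  have hcpt : IsCompact (closure Ω) := hΩbdd.isCompact_closure
  have hfin : volume Ω ≠ ⊤ := hΩbdd.measure_lt_top.ne
  have hfinm : IsFiniteMeasure (volume.restrict Ω) := ⟨by simpa using hfin.lt_top⟩
  obtain ⟨P, hP⟩ := hcpt.exists_bound_of_continuousOn hpC1.continuousOn
  have hP' : ∀ x ∈ Ω, p x ≤ P := fun x hx => (le_abs_self _).trans (hP x (subset_closure hx))
  have hqp' : ∀ x ∈ Ω, q ≤ p x := fun x hx => hqp x (subset_closure hx)
  have hp1' : ∀ x ∈ Ω, 1 < p x := fun x hx => hp1 x (subset_closure hx)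
  have hpm : AEMeasurable p (volume.restrict Ω) :=
    (hpC1.continuousOn.mono subset_closure).aemeasurable hΩopen.measurableSet
  have hvm : AEMeasurable v (volume.restrict Ω) := hvW.2.1.1.1.aemeasurable
  have hwm : AEMeasurable vt (volume.restrict Ω) := hwW.1.1.aemeasurable
  have hv2 : IntegrableOn (fun x => v x ^ (2 * q)) Ω := by
    have h1 := hvW.2.2.integrable_norm_rpow (by simpa using hq0) ENNReal.ofReal_ne_top
    rw [ENNReal.toReal_ofReal (by linarith)] at h1
    refine h1.congr ?_
    filter_upwards [hv0] with x hx
    rw [Real.norm_of_nonneg hx.le]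
  -- Both `h` and `v^q` are square integrable: `p₀ ≥ 2` on a set of finite measure, and `v ∈
  -- L^{2q}`.
  have hhv : IntegrableOn (fun x => h x * v x ^ q) Ω := by
    have h2 : IntegrableOn (fun x => h x ^ 2) Ω := (hh.mono_exponent hp₀).integrable_sq
    refine (h2.add hv2).mono' (hh.1.mul (hvm.pow_const q).aestronglyMeasurable) ?_
    filter_upwards [hv0, hhnonneg] with x hx hxh
    have e : v x ^ (2 * q) = (v x ^ q) ^ 2 := by
      rw [sq, ← Real.rpow_add hx]; congr 1; ring
    have e2 : 0 ≤ v x ^ q := by positivity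
    rw [Real.norm_of_nonneg (by positivity), Pi.add_apply, e]
    nlinarith [sq_nonneg (h x - v x ^ q), sq_nonneg (h x), sq_nonneg (v x ^ q)]
  -- The subsolution is itself an admissible test function.
  have hfv : IntegrableOn (fun x => f x (v x) * v x) Ω :=
    (hsub v G hvW (hv0.mono fun x hx => hx.le)).1
  have hGB := integrableOn_norm_rpow_mul_norm hΩopen hpm hp1' hvW.2.1.2.1 hwW.2.1
  let k : ℕ → ℝ := fun n => (n : ℝ) + 1
  let ε : ℕ → ℝ := fun n => 1 / ((n : ℝ) + 1)
  have hk : ∀ n, 0 < k n := fun n => by positivity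
  have hε : ∀ n, 0 < ε n := fun n => by positivity
  have hkt : Tendsto k atTop atTop :=
    tendsto_atTop_add_const_right _ _ tendsto_natCast_atTop_atTop
  have key := fun n => comparison_inequality hΩopen hfin hpm hqp' hP' hq1 hlam hh.1 hhv hhnonneg
    hf3 hvW hwW hv2 hfv hv0 hw0 hsub hsup (hk n) (hε n)
  have hαm : ∀ n, AEMeasurable (fun x => upperWeight q (k n) (ε n) (v x) (vt x))
      (volume.restrict Ω) := fun n =>
    (hvm.pow_const _).mul ((measurable_piconeTest q).comp_aemeasurable
      (((hvm.min aemeasurable_const).add_const _).prodMk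
        (((hvm.min aemeasurable_const).min hwm).add_const _)))
  have hβm : ∀ n, AEMeasurable (fun x => lowerWeight q (k n) (ε n) (v x) (vt x))
      (volume.restrict Ω) := fun n =>
    (hwm.pow_const _).mul ((measurable_piconeTest q).comp_aemeasurable
      ((((hvm.min aemeasurable_const).min hwm).add_const _).prodMk
        ((hvm.min aemeasurable_const).add_const _))).neg
  have hdiff : ∀ n, ∀ᵐ x ∂volume.restrict Ω,
      |upperWeight q (k n) (ε n) (v x) (vt x) - lowerWeight q (k n) (ε n) (v x) (vt x)|
        ≤ q * v x ^ q := fun n => by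
    filter_upwards [hv0, hw0] with x hx hx'
    have e1 := lowerWeight_le_upperWeight hq1 hx hx' (hk n) (hε n)
    have e2 := lowerWeight_nonneg hq1 hx hx' (hk n) (hε n)
    have e3 := upperWeight_le hq1 hx hx' (hk n) (hε n)
    rw [abs_of_nonneg (by linarith)]
    linarith
  have T0 : Tendsto (fun n => ∫ x in Ω, (v x ^ q - vt x ^ q) *
      upperWeight q (k n) (ε n) (v x) (vt x)) atTop
      (𝓝 (∫ x in Ω, (v x ^ q - vt x ^ q) * (v x ^ q - (min (v x) (vt x)) ^ q))) := by
    refine tendsto_integral_of_dominated_convergence (fun x => q * v x ^ (2 * q))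
      (fun n => (((hvm.pow_const _).sub (hwm.pow_const _)).mul (hαm n)).aestronglyMeasurable)
      (hv2.const_mul q) (fun n => ?_) ?_
    · filter_upwards [hv0, hw0] with x hx hx'
      exact abs_weight_le hq1 hx hx' (hk n) (hε n)
    · filter_upwards [hv0, hw0] with x hx hx'
      exact (tendsto_weights q hx hx').1.const_mul _
  -- At each point the integrand is zero as soon as `k n ≥ v x`; the dominating function is the
  -- integrable product of flux and gradient norms.
  have T1 : Tendsto (fun n => ∫ x in Ω, if k n < v x then q * (‖G x‖ ^ (p x - 1) * ‖B x‖) else 0)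
      atTop (𝓝 0) := by
    have := tendsto_integral_of_dominated_convergence (μ := volume.restrict Ω)
      (F := fun n x => if k n < v x then q * (‖G x‖ ^ (p x - 1) * ‖B x‖) else 0)
      (f := fun _ => 0) (fun x => q * (‖G x‖ ^ (p x - 1) * ‖B x‖)) (fun n => ?_)
      (hGB.const_mul q) (fun n => ?_) ?_
    · simpa using this
    · have hs : NullMeasurableSet {x | k n < v x} (volume.restrict Ω) :=
        nullMeasurableSet_lt aemeasurable_const hvm
      refine ((Integrable.indicator₀ (hGB.const_mul q) hs).congr
        (Eventually.of_forall fun x => ?_)).1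
      by_cases hx : k n < v x <;> simp [hx]
    · refine Eventually.of_forall fun x => ?_
      have : 0 ≤ q * (‖G x‖ ^ (p x - 1) * ‖B x‖) := by positivity
      split_ifs
      · rw [Real.norm_of_nonneg this]
      · simpa using this
    · refine Eventually.of_forall fun x => tendsto_const_nhds.congr' ?_
      filter_upwards [hkt.eventually_ge_atTop (v x)] with n hn
      rw [if_neg (not_lt.2 hn)]
  have T2 : Tendsto (fun n => ∫ x in Ω, h x * (upperWeight q (k n) (ε n) (v x) (vt x)
      - lowerWeight q (k n) (ε n) (v x) (vt x))) atTop (𝓝 0) := by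
    have := tendsto_integral_of_dominated_convergence (μ := volume.restrict Ω)
      (F := fun n x => h x * (upperWeight q (k n) (ε n) (v x) (vt x)
      - lowerWeight q (k n) (ε n) (v x) (vt x))) (f := fun _ => 0)
      (fun x => q * (h x * v x ^ q))
      (fun n => hh.1.mul ((hαm n).sub (hβm n)).aestronglyMeasurable)
      (hhv.const_mul q) (fun n => ?_) ?_
    · simpa using this
    · filter_upwards [hdiff n, hhnonneg] with x hx hxh
      rw [norm_mul, Real.norm_of_nonneg hxh, Real.norm_eq_abs]
      calc _ ≤ h x * (q * v x ^ q) := mul_le_mul_of_nonneg_left hx hxh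
        _ = _ := by ring
    · filter_upwards [hv0, hw0] with x hx hx'
      have ht := (tendsto_weights q hx hx').2.const_mul (h x)
      rw [mul_zero] at ht
      exact ht
  have T3 : Tendsto (fun n => ∫ x in Ω, f x (v x) * v x *
      ((upperWeight q (k n) (ε n) (v x) (vt x)
      - lowerWeight q (k n) (ε n) (v x) (vt x)) / v x ^ q)) atTop (𝓝 0) := by
    have := tendsto_integral_of_dominated_convergence (μ := volume.restrict Ω)
      (F := fun n x => f x (v x) * v x * ((upperWeight q (k n) (ε n) (v x) (vt x)
      - lowerWeight q (k n) (ε n) (v x) (vt x)) / v x ^ q)) (f := fun _ => 0)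
      (fun x => ‖f x (v x) * v x‖ * q)
      (fun n => hfv.1.mul (((hαm n).sub (hβm n)).div (hvm.pow_const _)).aestronglyMeasurable)
      (hfv.norm.mul_const q) (fun n => ?_) ?_
    · simpa using this
    · filter_upwards [hdiff n, hv0] with x hx hx0
      have e : 0 < v x ^ q := by positivity
      rw [norm_mul]
      apply mul_le_mul_of_nonneg_left _ (norm_nonneg _)
      rw [Real.norm_eq_abs, abs_div, abs_of_pos e]
      exact (div_le_iff₀ e).2 hx
    · filter_upwards [hv0, hw0] with x hx hx'
      have ht := ((tendsto_weights q hx hx').2.div_const (v x ^ q)).const_mul (f x (v x) * v x)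
      rw [zero_div, mul_zero] at ht
      exact ht
  have hle : ∫ x in Ω, (v x ^ q - vt x ^ q) * (v x ^ q - (min (v x) (vt x)) ^ q) ≤ 0 := by
    have hr := ((T1.const_mul lam).add T2).add (T3.const_mul lam)
    simp only [mul_zero, add_zero] at hr
    exact le_of_tendsto_of_tendsto' T0 hr key
  -- The limiting integrand equals `((v^q - vt^q)⁺)²`, strictly positive exactly where `vt < v`; a
  -- nonpositive integral therefore forces that set to be null.
  have hmin : ∀ᵐ x ∂volume.restrict Ω,
      (v x ≤ vt x → (v x ^ q - vt x ^ q) * (v x ^ q - (min (v x) (vt x)) ^ q) = 0) ∧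
      (vt x < v x → 0 < (v x ^ q - vt x ^ q) * (v x ^ q - (min (v x) (vt x)) ^ q) ∧
        (v x ^ q - vt x ^ q) * (v x ^ q - (min (v x) (vt x)) ^ q) ≤ v x ^ (2 * q)) := by
    filter_upwards [hv0, hw0] with x hx hx'
    refine ⟨fun hc => by rw [min_eq_left hc]; ring, fun hc => ?_⟩
    have e1 : vt x ^ q < v x ^ q := Real.rpow_lt_rpow hx'.le hc hq0
    have e2 : v x ^ (2 * q) = v x ^ q * v x ^ q := by
      rw [← Real.rpow_add hx]; congr 1; ring
    have e3 : 0 < vt x ^ q := by positivity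
    rw [min_eq_right hc.le, e2]
    exact ⟨mul_pos (by linarith) (by linarith), by nlinarith⟩
  have hnn : 0 ≤ᵐ[volume.restrict Ω]
      fun x => (v x ^ q - vt x ^ q) * (v x ^ q - (min (v x) (vt x)) ^ q) := by
    filter_upwards [hmin] with x hx
    rcases le_or_gt (v x) (vt x) with hc | hc
    · exact (hx.1 hc).ge
    · exact (hx.2 hc).1.le
  have hint : IntegrableOn
      (fun x => (v x ^ q - vt x ^ q) * (v x ^ q - (min (v x) (vt x)) ^ q)) Ω := by
    refine hv2.mono' (((hvm.pow_const _).sub (hwm.pow_const _)).mul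
      ((hvm.pow_const _).sub ((hvm.min hwm).pow_const _))).aestronglyMeasurable ?_
    filter_upwards [hmin, hv0] with x hx hx0
    rcases le_or_gt (v x) (vt x) with hc | hc
    · rw [hx.1 hc, norm_zero]; positivity
    · rw [Real.norm_of_nonneg (hx.2 hc).1.le]; exact (hx.2 hc).2
  have hzero := (integral_eq_zero_iff_of_nonneg_ae hnn hint).1
    (le_antisymm hle (integral_nonneg_of_ae hnn))
  filter_upwards [hzero, hmin] with x hx hxm
  by_contra hc
  exact (hxm.2 (not_le.1 hc)).1.ne' hx
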